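/- Let $P\subset\mathbb R^4$ be a simple convex polytope (compact, with non-empty interior, exactly four edges at each vertex), and let $V$ be a vertex of $P$ such that every edge of $P$ containing $V$ is skew. Then: (1) The spherical polytope $\Delta=\mathrm{Spher}(V)\subset S^3$ has an interior point $Y$ such that the spherical squared distance function $SQD_Y^{\Delta}:\partial\Delta\to\mathbb R$ has at least $8$ critical points at spherical distance less than $\pi/2$ from $Y$. (2) $V$ is a nice face of $P$. In particular, if all edges of a simple $4$-polytope are skew, then (1) and (2) hold for each of its vertices. Here, for a face $F$ of a polytope $P\subset\mathbb R^n$, $\mathrm{Spher}(F)$ is the set of unit vectors that are orthogonal to $F$ and point from a point of the relative interior of $F$ into $P$. An edge $F$ of $P\subset\mathbb R^4$ is skew if there is no interior point $X$ of the spherical triangle $\mathrm{Spher}(F)$ that projects orthogonally to the relative interior of each of the three edges of this triangle and is at distance less than $\pi/2$ from each of its three vertices. A point $z$ is a critical point of the (Euclidean or spherical) squared distance function from an interior point $y$ to the boundary of a (Euclidean or spherical) convex polyhedron $C$ if, for some proper face $G$ of $C$, $z$ is the orthogonal projection of $y$ to the flat (respectively great sphere) spanned by $G$, $z$ lies in the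 relative interior of $G$, and the segment (respectively geodesic) $zy$ makes an angle not greater than $\pi/2$ with $zx$ for all $x\in C$. The cone $CF$ of a face $F$ is the positive span of $P$ as seen from a point of the relative interior of $F$. An $(n-k)$-face $F$ with $k\ge3$ is nice if for some interior point $y$ of $CF$ the squared distance function from $y$ has at least $2k+1$ critical points on the faces of $CF$; thus for a vertex of a $4$-polytope at least $9$ critical points are required. -/

import Mathlib

noncomputable section

namespace PolytopeNormals

variable {E : Type*} [NormedAddCommGroup E] [InnerProductSpace ℝ E]

/-! ### Polytopes and their faces -/

/-- A compact convex polytope with non-empty interior. -/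
def IsPolytope (P : Set E) : Prop :=
  (∃ s : Finset E, P = convexHull ℝ (s : Set E)) ∧ (interior P).Nonempty

/-- `F` is a (non-empty, proper) face of the convex set `C`: the intersection of `C` with
a support hyperplane. -/
def IsFace (C F : Set E) : Prop :=
  F.Nonempty ∧ F ≠ C ∧ IsExposed ℝ C F

/-- The dimension of (the affine hull of) a non-empty convex set. -/
def dim (F : Set E) : ℕ := Module.finrank ℝ (vectorSpan ℝ F)

/-- `v` is a vertex of `P`. -/
def IsVertex (P : Set E) (v : E) : Prop := IsFace P {v}

/-- `e` is an edge of `P`. -/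
def IsEdge (P e : Set E) : Prop := IsFace P e ∧ dim e = 1

/-- A full-dimensional polytope in `n`-space is simple if exactly `n` edges emanate from each of
its vertices. -/
def IsSimple (P : Set E) : Prop :=
  ∀ v, IsVertex P v → {e | IsEdge P e ∧ v ∈ e}.encard = Module.finrank ℝ E

/-- The cone `CF` of a face `F` of `P`: the positive span of `P` as seen from a point `x` of the
relative interior of `F` (it does not depend on `x`). It is kept in place, so that it contains
`P` and is bounded by the extensions of the facets of `P` that contain `F`. -/
def faceCone (P F : Set E) : Set E :=
  {y | ∃ x ∈ intrinsicInterior ℝ F, ∃ p ∈ P, ∃ t : ℝ, 0 ≤ t ∧ y = x + t • (p - x)}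

/-- The critical points of the squared distance function `x ↦ |x - y|²` on the boundary of the
convex polyhedron `C`, for `y` in the interior of `C`. The point `z` is critical if it lies in the
relative interior of a face `G`, it is the orthogonal projection of `y` to the affine hull of `G`,
and the vector from `z` to `y` makes with `zx` an angle not greater than `π/2`, for all
`x` in `C`. -/
def criticalPoints (C : Set E) (y : E) : Set E :=
  {z | ∃ G, IsFace C G ∧ z ∈ intrinsicInterior ℝ G ∧ y - z ∈ (vectorSpan ℝ G)ᗮ ∧
    ∀ x ∈ C, EuclideanGeometry.angle y z x ≤ Real.pi / 2}

/-- A face `F` of codimension `k ≥ 3` of `P` is nice if for some point `y` inside the cone of `F`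
the squared distance function from `y` has at least `2k + 1` critical points on the faces of
this cone. -/
def IsNiceFace (P F : Set E) : Prop :=
  IsFace P F ∧ ∃ k : ℕ, 3 ≤ k ∧ dim F + k = Module.finrank ℝ E ∧
    ∃ y ∈ interior (faceCone P F), ((2 * k + 1 : ℕ) : ℕ∞) ≤ (criticalPoints (faceCone P F) y).encard

/-! ### Spherical polytopes

A spherical polytope is represented by its set of points, which are unit vectors of `E`; the
spherical distance of two points is the angle between them. -/

/-- The spherical polytope `Spher(F)` of a face `F` of `P`: the set of unit vectors orthogonal
to `F` that point from a point of the relative interior of `F` into `P`, that is, the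
intersection of a small sphere centered at that point, rescaled to radius one, with `P` and with
the orthogonal complement of `F`. -/
def spher (P F : Set E) : Set E :=
  {u | ‖u‖ = 1 ∧ u ∈ (vectorSpan ℝ F)ᗮ ∧
    ∃ x ∈ intrinsicInterior ℝ F, ∃ ε : ℝ, 0 < ε ∧ x + ε • u ∈ P}

/-- The relative interior of a spherically convex set `S`: the unit vectors in the
relative interior of the cone with apex `0` over `S`. -/
def sphInterior (S : Set E) : Set E :=
  {z ∈ S | z ∈ intrinsicInterior ℝ {w : E | ∃ t : ℝ, 0 ≤ t ∧ ∃ s ∈ S, w = t • s}}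

/-- `G` is a (non-empty, proper) face of the spherical polytope `S`: the intersection of `S` with
a supporting great hypersphere. -/
def IsSphFace (S G : Set E) : Prop :=
  G.Nonempty ∧ G ≠ S ∧
    ∃ a : E, (∀ x ∈ S, 0 ≤ inner ℝ a x) ∧ G = {x ∈ S | inner ℝ a x = 0}

/-- The spherical dimension of `G` is `m`, that is, `G` spans a great sphere of
dimension `m`. -/
def HasSphDim (G : Set E) (m : ℕ) : Prop :=
  Module.finrank ℝ (Submodule.span ℝ G) = m + 1

/-- The point `X` of the unit sphere projects to the point `z` of the spherical face `G`: the
spherical orthogonal projection of `X` to the great sphere spanned by `G` (the linear projection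
to the span, divided by its norm) is `z`, and `z` lies in the relative interior of `G`. -/
def SphProjectsTo (X : E) (G : Set E) (z : E) : Prop :=
  z ∈ sphInterior G ∧ ∃ c : ℝ, 0 < c ∧ X - c • z ∈ (Submodule.span ℝ G)ᗮ

/-- A vector of the direction in which the geodesic from the point `z` of the unit sphere to
the point `x` leaves `z`. -/
def sphDir (z x : E) : E := x - inner ℝ z x • z

/-- The critical points of the spherical squared distance function from the
interior point `Y` on the boundary of the spherical polytope `S`: those points `z` to which `Y`
projects on some face of `S`, and such that the geodesic from `z` to `Y` makes an angle not
greater than `π/2` with the geodesic from `z` to `x`, for all `x` in `S`. -/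
def sphCriticalPoints (S : Set E) (Y : E) : Set E :=
  {z | ∃ G, IsSphFace S G ∧ SphProjectsTo Y G z ∧
    ∀ x ∈ S, InnerProductGeometry.angle (sphDir z Y) (sphDir z x) ≤ Real.pi / 2}

/-- A spherical triangle is nice if some interior point `X` projects to (the relative interior
of) each of its edges and is at distance less than `π/2` from each of its vertices. -/
def IsNiceTriangle (T : Set E) : Prop :=
  ∃ X ∈ sphInterior T,
    (∀ e, IsSphFace T e → HasSphDim e 1 → ∃ z, SphProjectsTo X e z) ∧
    (∀ v, IsSphFace T {v} → InnerProductGeometry.angle X v < Real.pi / 2)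

/-- A face of codimension three of `P` is skew if its spherical triangle is not nice. -/
def IsSkewFace (P F : Set E) : Prop :=
  IsFace P F ∧ dim F + 3 = Module.finrank ℝ E ∧ ¬ IsNiceTriangle (spher P F)

end PolytopeNormals

end

/-! At a vertex of a simple 4-polytope the tangent cone is simplicial, so all the geometry there is
encoded by the unit facet normals `n i` and the dual edge directions `u i`. A foot point z on the
face with active normals J is critical for Y when it lies inside that face and Y - z is a
non-negative combination of the active normals (`IsCriticalFor`). Everything becomes inequalities
between two mutually inverse Gram matrices.

The sides of the spherical triangle of the edge along `u l` have the other three normals. If the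
triangle is not nice, two explicit trial points, one of them the incenter, must fail. This forces
exactly one of the three products of normals to be positive, together with an inequality 1 + ⟪n i, n
j⟫ ≤ ⟪n i, n k⟫ + ⟪n j, n k⟫ (`exists_shape_of_not_isNiceTriangle`). Over the four triangles the
positive pairs form a perfect matching, labeled {0,1}, {2,3}; the inequalities compare neighbouring
negative products, and after excluding the cyclic and the alternating pattern the labels can be
chosen so that ⟪n 0, n 2⟫ is least.

For such normals a point with two critical facets and three critical rays exists
(`IsDualPair.exists_isGoodPoint`). Jacobi's identity `gram_minor` gives the signs of the products ⟪u
i, u j⟫, and a perturbation argument then gives the coordinates ⟪Y, u i⟫. On the 2-sphere bounding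
the spherical simplex the facets are minima and the rays maxima, so the Euler count 2 - 3 + 3 = 2
suggests three saddles; `IsGoodPoint.exists_critical` finds them on two-dimensional faces. These
eight points, normalized, prove (1); the apex is the ninth critical point for (2). -/

noncomputable section

namespace PolytopeNormals

open scoped RealInnerProductSpace

variable {E : Type*} [NormedAddCommGroup E] [InnerProductSpace ℝ E]

/-! ### Simplicial cones, spherical simplices and dual bases. -/

section

variable {ι : Type*}

/-- The face of the simplicial cone in `W` with inner normals `n` on which the normals with
indices in `J` vanish. -/
def coneFace (W : Submodule ℝ E) (n : ι → E) (J : Finset ι) : Set E :=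
  {x | x ∈ W ∧ (∀ i, 0 ≤ ⟪x, n i⟫) ∧ ∀ j ∈ J, ⟪x, n j⟫ = 0}

/-- The unit vectors of `coneFace W n J`. -/
def sphFace (W : Submodule ℝ E) (n : ι → E) (J : Finset ι) : Set E :=
  {x | ‖x‖ = 1 ∧ x ∈ coneFace W n J}

/-- The affine span of `s` lies in `A`, so the span itself never has to be computed. -/
theorem mem_intrinsicInterior_of_isOpen {s O : Set E} {A : AffineSubspace ℝ E} {z : E}
    (hs : s ⊆ A) (hO : IsOpen O) (hz : z ∈ O) (hzs : z ∈ s) (h : O ∩ A ⊆ s) :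
    z ∈ intrinsicInterior ℝ s := by
  rw [mem_intrinsicInterior]
  refine ⟨⟨z, subset_affineSpan ℝ s hzs⟩, ?_, rfl⟩
  rw [mem_interior]
  refine ⟨((↑) : affineSpan ℝ s → E) ⁻¹' O, ?_, hO.preimage continuous_subtype_val, hz⟩
  intro x hx
  exact h ⟨hx, affineSpan_le.2 hs x.2⟩

theorem isOpen_forall_inner_pos [Finite ι] (n : ι → E) (J : Finset ι) (V : E) :
    IsOpen {x : E | ∀ i ∉ J, 0 < ⟪x - V, n i⟫} := by
  have : {x : E | ∀ i ∉ J, 0 < ⟪x - V, n i⟫} = ⋂ i ∈ {i | i ∉ J}, {x : E | 0 < ⟪x - V, n i⟫} := by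
    ext x; simp
  rw [this]
  refine Set.Finite.isOpen_biInter (Set.toFinite _) fun i _ => ?_
  exact isOpen_lt continuous_const (by fun_prop)

/-- The subspace spanned by `coneFace W n J`. -/
def faceSpan (W : Submodule ℝ E) (n : ι → E) (J : Finset ι) : Submodule ℝ E :=
  W ⊓ (Submodule.span ℝ (n '' J))ᗮ

theorem mem_faceSpan {W : Submodule ℝ E} {n : ι → E} {J : Finset ι} {x : E} :
    x ∈ faceSpan W n J ↔ x ∈ W ∧ ∀ j ∈ J, ⟪x, n j⟫ = 0 := by
  unfold faceSpan
  rw [Submodule.mem_inf]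
  refine and_congr_right fun _ => ⟨fun h j hj => ?_, fun h => ?_⟩
  · rw [real_inner_comm]
    exact (Submodule.mem_orthogonal _ _).1 h _ (Submodule.subset_span ⟨j, hj, rfl⟩)
  · rw [Submodule.mem_orthogonal]
    intro u hu
    induction hu using Submodule.span_induction with
    | mem y hy => obtain ⟨j, hj, rfl⟩ := hy; rw [real_inner_comm]; exact h j hj
    | zero => simp
    | add a b _ _ ha hb => rw [inner_add_left, ha, hb, add_zero]
    | smul c a _ ha => rw [real_inner_smul_left, ha, mul_zero]

theorem mem_intrinsicInterior_coneFace [Finite ι] {W : Submodule ℝ E} {n : ι → E} {J : Finset ι} {z : E}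
    (V : E) (hzW : z ∈ W) (h0 : ∀ j ∈ J, ⟪z, n j⟫ = 0) (hpos : ∀ i ∉ J, 0 < ⟪z, n i⟫) :
    V + z ∈ intrinsicInterior ℝ {x | x - V ∈ coneFace W n J} := by
  refine mem_intrinsicInterior_of_isOpen (O := {x : E | ∀ i ∉ J, 0 < ⟪x - V, n i⟫})
    (A := AffineSubspace.mk' V (faceSpan W n J)) ?_ (isOpen_forall_inner_pos n J V) ?_ ?_ ?_
  · intro x hx
    rw [SetLike.mem_coe, AffineSubspace.mem_mk', vsub_eq_sub, mem_faceSpan]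
    exact ⟨hx.1, hx.2.2⟩
  · simpa using hpos
  · refine ⟨by simpa using hzW, fun i => ?_, by simpa using h0⟩
    by_cases hi : i ∈ J
    · simp [h0 i hi]
    · simpa using (hpos i hi).le
  · rintro x ⟨hx, hxA⟩
    rw [SetLike.mem_coe, AffineSubspace.mem_mk', vsub_eq_sub, mem_faceSpan] at hxA
    refine ⟨hxA.1, fun i => ?_, hxA.2⟩
    by_cases hi : i ∈ J
    · rw [hxA.2 i hi]
    · exact (hx i hi).le

theorem smul_mem_coneFace {W : Submodule ℝ E} {n : ι → E} {J : Finset ι} {x : E} {t : ℝ}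
    (ht : 0 ≤ t) (hx : x ∈ coneFace W n J) : t • x ∈ coneFace W n J := by
  refine ⟨W.smul_mem _ hx.1, fun i => ?_, fun j hj => ?_⟩
  · rw [real_inner_smul_left]; exact mul_nonneg ht (hx.2.1 i)
  · rw [real_inner_smul_left, hx.2.2 j hj, mul_zero]

theorem normalize_mem_sphFace {W : Submodule ℝ E} {n : ι → E} {J : Finset ι} {x : E}
    (h0 : x ≠ 0) (hx : x ∈ coneFace W n J) : ‖x‖⁻¹ • x ∈ sphFace W n J :=
  ⟨norm_smul_inv_norm (𝕜 := ℝ) h0, smul_mem_coneFace (by positivity) hx⟩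

theorem cone_sphFace {W : Submodule ℝ E} {n : ι → E} {J : Finset ι}
    (hne : (sphFace W n J).Nonempty) :
    {w : E | ∃ t : ℝ, 0 ≤ t ∧ ∃ s ∈ sphFace W n J, w = t • s} = coneFace W n J := by
  ext x
  constructor
  · rintro ⟨t, ht, s, hs, rfl⟩
    exact smul_mem_coneFace ht hs.2
  · intro hx
    by_cases h0 : x = 0
    · obtain ⟨s, hs⟩ := hne
      exact ⟨0, le_rfl, s, hs, by simp [h0]⟩
    · refine ⟨‖x‖, norm_nonneg _, _, normalize_mem_sphFace h0 hx, ?_⟩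
      rw [smul_smul, mul_inv_cancel₀ (norm_ne_zero_iff.2 h0), one_smul]

/-- A non-zero vector in the relative interior of the cone over a spherical face. -/
theorem normalize_mem_sphInterior [Finite ι] {W : Submodule ℝ E} {n : ι → E} {J : Finset ι} {z : E}
    (hz : z ≠ 0) (hzW : z ∈ W) (h0 : ∀ j ∈ J, ⟪z, n j⟫ = 0) (hpos : ∀ i ∉ J, 0 < ⟪z, n i⟫) :
    ‖z‖⁻¹ • z ∈ sphInterior (sphFace W n J) := by
  have hc : 0 < ‖z‖⁻¹ := inv_pos.2 (norm_pos_iff.2 hz)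
  have hzc : z ∈ coneFace W n J := by
    refine ⟨hzW, fun i => ?_, h0⟩
    by_cases hi : i ∈ J
    · rw [h0 i hi]
    · exact (hpos i hi).le
  have hm := normalize_mem_sphFace hz hzc
  refine ⟨hm, ?_⟩
  rw [cone_sphFace ⟨_, hm⟩]
  have := mem_intrinsicInterior_coneFace (W := W) (n := n) (J := J) (z := ‖z‖⁻¹ • z) 0
    (W.smul_mem _ hzW) (fun j hj => by rw [real_inner_smul_left, h0 j hj, mul_zero])
    (fun i hi => by rw [real_inner_smul_left]; exact mul_pos hc (hpos i hi))
  simpa using this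

section Dual

variable [Fintype ι] [DecidableEq ι]

/-- `w` and `n` are dual bases of the subspace `W`. -/
structure IsDualPair (W : Submodule ℝ E) (n w : ι → E) : Prop where
  inner_eq : ∀ i j, ⟪w i, n j⟫ = if i = j then 1 else 0
  n_mem : ∀ i, n i ∈ W
  w_mem : ∀ i, w i ∈ W
  expand : ∀ x ∈ W, x = ∑ i, ⟪x, n i⟫ • w i

namespace IsDualPair

variable {W : Submodule ℝ E} {n w : ι → E}

theorem inner_self (h : IsDualPair W n w) (i : ι) : ⟪w i, n i⟫ = 1 := by simp [h.inner_eq]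

theorem inner_ne (h : IsDualPair W n w) {i j : ι} (hij : i ≠ j) : ⟪w i, n j⟫ = 0 := by
  simp [h.inner_eq, hij]

theorem w_ne_zero (h : IsDualPair W n w) (i : ι) : w i ≠ 0 := fun h0 => by
  have := h.inner_self i
  simp [h0] at this

theorem inner_expand (h : IsDualPair W n w) {x : E} (hx : x ∈ W) (y : E) :
    ⟪x, y⟫ = ∑ i, ⟪x, n i⟫ * ⟪w i, y⟫ := by
  conv_lhs => rw [h.expand x hx]
  simp [sum_inner, real_inner_smul_left]

theorem ext_inner (h : IsDualPair W n w) {x : E} (hx : x ∈ W) (h0 : ∀ i, ⟪x, w i⟫ = 0) :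
    x = 0 := by
  rw [← inner_self_eq_zero (𝕜 := ℝ), h.inner_expand hx]
  exact Finset.sum_eq_zero fun i _ => by rw [real_inner_comm x (w i), h0, mul_zero]

/-- By `ext_inner` the expansion along `n` is detected by products with `w`. Hence every fact about
generators has a twin about normals. -/
theorem symm (h : IsDualPair W n w) : IsDualPair W w n where
  inner_eq i j := by
    rw [real_inner_comm, h.inner_eq]
    simp only [eq_comm]
  n_mem := h.w_mem
  w_mem := h.n_mem
  expand x hx := by
    rw [← sub_eq_zero]
    refine h.ext_inner (W.sub_mem hx (W.sum_mem fun i _ => W.smul_mem _ (h.n_mem i))) fun j => ?_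
    rw [inner_sub_left, sum_inner, Finset.sum_eq_single j]
    · rw [real_inner_smul_left, real_inner_comm (w j) (n j), h.inner_self, mul_one, sub_self]
    · intro b _ hb
      rw [real_inner_smul_left, real_inner_comm (w j) (n b), h.inner_ne hb.symm, mul_zero]
    · simp

theorem linearIndependent (h : IsDualPair W n w) : LinearIndependent ℝ w := by
  rw [Fintype.linearIndependent_iff]
  intro g hg i
  have := congrArg (fun x => ⟪x, n i⟫) hg
  simpa [sum_inner, real_inner_smul_left, h.inner_eq] using this

theorem w_mem_coneFace (h : IsDualPair W n w) {J : Finset ι} {k : ι} (hk : k ∉ J) :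
    w k ∈ coneFace W n J := by
  refine ⟨h.w_mem k, fun i => ?_, fun j hj => h.inner_ne (by rintro rfl; exact hk hj)⟩
  rw [h.inner_eq]; split_ifs <;> simp

/-- A vector that is orthogonal to all generators of a face is orthogonal to the face. -/
theorem inner_eq_zero_of_mem_coneFace (h : IsDualPair W n w) {J : Finset ι} {x v : E}
    (hx : x ∈ coneFace W n J) (hv : ∀ k ∉ J, ⟪v, w k⟫ = 0) : ⟪x, v⟫ = 0 := by
  rw [h.inner_expand hx.1]
  refine Finset.sum_eq_zero fun k _ => ?_
  by_cases hk : k ∈ J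
  · rw [hx.2.2 k hk, zero_mul]
  · rw [real_inner_comm v (w k), hv k hk, mul_zero]

theorem mem_orthogonal_span_sphFace (h : IsDualPair W n w) {J : Finset ι} {v : E}
    (hv : ∀ k ∉ J, ⟪v, w k⟫ = 0) : v ∈ (Submodule.span ℝ (sphFace W n J))ᗮ := by
  rw [Submodule.mem_orthogonal]
  intro x hx
  induction hx using Submodule.span_induction with
  | mem y hy => exact h.inner_eq_zero_of_mem_coneFace hy.2 hv
  | zero => simp
  | add a b _ _ ha hb => rw [inner_add_left, ha, hb, add_zero]
  | smul c a _ ha => rw [real_inner_smul_left, ha, mul_zero]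

theorem span_sphFace (h : IsDualPair W n w) (J : Finset ι) :
    Submodule.span ℝ (sphFace W n J) = Submodule.span ℝ (Set.range fun k : {k // k ∉ J} => w k) := by
  refine le_antisymm (Submodule.span_le.2 fun x hx => ?_) (Submodule.span_le.2 ?_)
  · rw [SetLike.mem_coe, h.expand x hx.2.1]
    refine Submodule.sum_mem _ fun k _ => ?_
    by_cases hk : k ∈ J
    · rw [hx.2.2.2 k hk, zero_smul]; exact Submodule.zero_mem _
    · exact Submodule.smul_mem _ _ (Submodule.subset_span ⟨⟨k, hk⟩, rfl⟩)
  · rintro _ ⟨⟨k, hk⟩, rfl⟩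
    have h1 := Submodule.subset_span (R := ℝ)
      (normalize_mem_sphFace (h.w_ne_zero k) (h.w_mem_coneFace hk))
    have h2 := Submodule.smul_mem _ ‖w k‖ h1
    rwa [smul_smul, mul_inv_cancel₀ (norm_ne_zero_iff.2 (h.w_ne_zero k)), one_smul] at h2

theorem finrank_span_sphFace (h : IsDualPair W n w) (J : Finset ι) :
    Module.finrank ℝ (Submodule.span ℝ (sphFace W n J)) = Jᶜ.card := by
  have hli : LinearIndependent ℝ fun k : {k // k ∉ J} => w k :=
    h.linearIndependent.comp (fun k : {k // k ∉ J} => (k : ι)) Subtype.val_injective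
  rw [h.span_sphFace, finrank_span_eq_card hli, Fintype.card_subtype]
  congr 1
  ext; simp

/-- Every face of a spherical simplex is given by the vanishing of some of the normals. -/
theorem isSphFace_eq (h : IsDualPair W n w) {G : Set E} (hG : IsSphFace (sphFace W n ∅) G) :
    ∃ J : Finset ι, G = sphFace W n J := by
  obtain ⟨-, -, a, ha, rfl⟩ := hG
  have haw : ∀ i, 0 ≤ ⟪a, w i⟫ := fun i => by
    have := ha _ (normalize_mem_sphFace (h.w_ne_zero i) (h.w_mem_coneFace (by simp)))
    rw [real_inner_smul_right] at this
    exact nonneg_of_mul_nonneg_right this (inv_pos.2 (norm_pos_iff.2 (h.w_ne_zero i)))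
  -- Points of the cone are non-negative combinations of the `w i`, so `a` vanishes at one only if
  -- no generator with positive pairing occurs in it.
  refine ⟨Finset.univ.filter fun i => 0 < ⟪a, w i⟫, ?_⟩
  ext x
  constructor
  · rintro ⟨hx, hax⟩
    refine ⟨hx.1, hx.2.1, hx.2.2.1, fun j hj => ?_⟩
    rw [real_inner_comm, h.inner_expand hx.2.1,
      Finset.sum_eq_zero_iff_of_nonneg fun i _ => mul_nonneg (hx.2.2.1 i)
        (by rw [real_inner_comm]; exact haw i)] at hax
    have := hax j (Finset.mem_univ j)
    rw [real_inner_comm a (w j)] at this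
    exact (mul_eq_zero.1 this).resolve_right (Finset.mem_filter.1 hj).2.ne'
  · intro hx
    refine ⟨⟨hx.1, hx.2.1, hx.2.2.1, by simp⟩, ?_⟩
    rw [real_inner_comm]
    refine h.inner_eq_zero_of_mem_coneFace hx.2 fun k hk => ?_
    refine le_antisymm ?_ (haw k)
    simpa using hk

end IsDualPair

end Dual

end

/-! ### Spherical triangles that are not nice. -/

section

theorem angle_le_pi_div_two_iff (x y : E) :
    InnerProductGeometry.angle x y ≤ Real.pi / 2 ↔ 0 ≤ ⟪x, y⟫ := by
  rw [InnerProductGeometry.angle, Real.arccos_le_pi_div_two]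
  by_cases hx : x = 0
  · simp [hx]
  by_cases hy : y = 0
  · simp [hy]
  have : 0 < ‖x‖ * ‖y‖ := mul_pos (norm_pos_iff.2 hx) (norm_pos_iff.2 hy)
  rw [le_div_iff₀ this, zero_mul]

theorem angle_lt_pi_div_two_of_inner_pos {x y : E} (h : 0 < ⟪x, y⟫) :
    InnerProductGeometry.angle x y < Real.pi / 2 := by
  rw [InnerProductGeometry.angle, Real.arccos_lt_pi_div_two]
  refine div_pos h (mul_pos (norm_pos_iff.2 ?_) (norm_pos_iff.2 ?_)) <;> rintro rfl <;> simp at h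

/-- `X` projects to the normalization of `z`, when `z` is the orthogonal projection of `X` to the
span of a face and lies in the relative interior of the cone over this face. -/
theorem IsDualPair.sphProjectsTo {ι : Type*} [Fintype ι] [DecidableEq ι] {W : Submodule ℝ E}
    {n w : ι → E} (h : IsDualPair W n w) {J : Finset ι} {X z : E} (hz : z ≠ 0) (hzW : z ∈ W)
    (h0 : ∀ j ∈ J, ⟪z, n j⟫ = 0) (hpos : ∀ i ∉ J, 0 < ⟪z, n i⟫)
    (horth : ∀ k ∉ J, ⟪X - z, w k⟫ = 0) : SphProjectsTo X (sphFace W n J) (‖z‖⁻¹ • z) := by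
  refine ⟨normalize_mem_sphInterior hz hzW h0 hpos, ‖z‖, norm_pos_iff.2 hz, ?_⟩
  rw [smul_smul, mul_inv_cancel₀ (norm_ne_zero_iff.2 hz), one_smul]
  exact h.mem_orthogonal_span_sphFace horth

section Triangle

variable {ι : Type*} [Fintype ι] [DecidableEq ι] {W : Submodule ℝ E} {n w : ι → E}

namespace IsDualPair

theorem sq_inner_lt_one (h : IsDualPair W n w) (hn : ∀ i, ‖n i‖ = 1) {i j : ι} (hij : i ≠ j) :
    ⟪n i, n j⟫ ^ 2 < 1 := by
  have h0 : n i - ⟪n i, n j⟫ • n j ≠ 0 := fun h0 => by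
    have := congrArg (fun x => ⟪w i, x⟫) h0
    simp [inner_sub_right, real_inner_smul_right, h.inner_self, h.inner_ne hij] at this
  have h1 := real_inner_self_pos.2 h0
  have hs : ∀ x, ⟪n x, n x⟫ = 1 := fun x => by rw [real_inner_self_eq_norm_sq, hn, one_pow]
  simp only [inner_sub_left, inner_sub_right, real_inner_smul_left, real_inner_smul_right, hs,
    real_inner_comm (n i) (n j)] at h1
  nlinarith

theorem abs_inner_lt_one (h : IsDualPair W n w) (hn : ∀ i, ‖n i‖ = 1) {i j : ι} (hij : i ≠ j) :
    -1 < ⟪n i, n j⟫ ∧ ⟪n i, n j⟫ < 1 :=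
  abs_lt.1 ((sq_lt_one_iff_abs_lt_one _).1 (h.sq_inner_lt_one hn hij))

/-- The determinant of the Gram matrix of three of the vectors `w` is positive. -/
theorem gram_three_pos (h : IsDualPair W n w) {i j k : ι} (hij : i ≠ j) (hik : i ≠ k)
    (hjk : j ≠ k) :
    0 < ⟪w i, w i⟫ * ⟪w j, w j⟫ * ⟪w k, w k⟫ + 2 * ⟪w i, w j⟫ * ⟪w i, w k⟫ * ⟪w j, w k⟫
      - ⟪w i, w i⟫ * ⟪w j, w k⟫ ^ 2 - ⟪w j, w j⟫ * ⟪w i, w k⟫ ^ 2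
      - ⟪w k, w k⟫ * ⟪w i, w j⟫ ^ 2 := by
  have hinj : Function.Injective ![i, j, k] := by
    intro a b hab
    fin_cases a <;> fin_cases b <;> simp_all
  have hp := (Matrix.posDef_gram_of_linearIndependent (𝕜 := ℝ)
    (h.linearIndependent.comp _ hinj)).det_pos
  rw [Matrix.det_fin_three] at hp
  simp only [Matrix.gram_apply, Function.comp, Matrix.cons_val_zero, Matrix.cons_val_one,
    Matrix.cons_val] at hp
  rw [real_inner_comm (w i) (w j), real_inner_comm (w i) (w k), real_inner_comm (w j) (w k)] at hp
  nlinarith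

/-- `hXn` puts X inside, `hXw` bounds the distances to the vertices, and `hf` says that the foot X -
⟪X, n i⟫ n i lies inside side i. All are invariant under scaling X. -/
theorem isNiceTriangle (h : IsDualPair W n w) (hn : ∀ i, ‖n i‖ = 1) (hcard : Fintype.card ι = 3)
    {X : E} (hX : X ∈ W) (hXn : ∀ i, 0 < ⟪X, n i⟫) (hXw : ∀ i, 0 < ⟪X, w i⟫)
    (hf : ∀ i j, i ≠ j → ⟪X, n i⟫ * ⟪n i, n j⟫ < ⟪X, n j⟫) :
    IsNiceTriangle (sphFace W n ∅) := by
  have hι : Nonempty ι := Fintype.card_pos_iff.1 (by omega)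
  have hX0 : X ≠ 0 := by
    rintro rfl
    obtain ⟨i⟩ := hι
    simpa using hXn i
  have hc : 0 < ‖X‖⁻¹ := inv_pos.2 (norm_pos_iff.2 hX0)
  refine ⟨‖X‖⁻¹ • X, normalize_mem_sphInterior hX0 hX (by simp) (fun i _ => hXn i), ?_, ?_⟩
  · intro e he hd
    obtain ⟨J, rfl⟩ := h.isSphFace_eq he
    rw [HasSphDim, h.finrank_span_sphFace, Finset.card_compl, hcard] at hd
    have hJ1 : J.card = 1 := by have := Finset.card_le_univ J; omega
    obtain ⟨i, rfl⟩ := Finset.card_eq_one.1 hJ1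
    set z := ‖X‖⁻¹ • (X - ⟪X, n i⟫ • n i) with hz
    have hzi : ⟪z, n i⟫ = 0 := by
      rw [hz, real_inner_smul_left, inner_sub_left, real_inner_smul_left,
        real_inner_self_eq_norm_sq, hn]
      ring
    have hzj : ∀ j ∉ ({i} : Finset ι), 0 < ⟪z, n j⟫ := fun j hj => by
      rw [hz, real_inner_smul_left, inner_sub_left, real_inner_smul_left]
      exact mul_pos hc (sub_pos.2 (hf i j (by simpa [eq_comm] using hj)))
    have hz0 : z ≠ 0 := by
      obtain ⟨j, hj⟩ : ∃ j, j ≠ i := by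
        have : Nontrivial ι := Fintype.one_lt_card_iff_nontrivial.1 (by omega)
        exact exists_ne i
      intro h0
      simpa [h0] using hzj j (by simpa using hj)
    refine ⟨_, h.sphProjectsTo hz0 (W.smul_mem _ (W.sub_mem hX (W.smul_mem _ (h.n_mem i))))
      (by simpa using hzi) hzj fun k hk => ?_⟩
    rw [hz, ← smul_sub, sub_sub_cancel, smul_smul, real_inner_smul_left,
      real_inner_comm (w k) (n i), h.inner_ne (by simpa using hk), mul_zero]
  · intro v hv
    obtain ⟨J, hJ⟩ := h.isSphFace_eq hv
    have hvm : v ∈ sphFace W n J := hJ ▸ rfl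
    obtain ⟨k, hk⟩ : ∃ k, k ∉ J := by
      by_contra! hall
      have hv0 := h.expand v hvm.2.1
      rw [Finset.sum_eq_zero fun i _ => by rw [hvm.2.2.2 i (hall i), zero_smul]] at hv0
      have := hvm.1
      simp [hv0] at this
    have hkv : ‖w k‖⁻¹ • w k = v := by
      have := normalize_mem_sphFace (h.w_ne_zero k) (h.w_mem_coneFace hk)
      rwa [← hJ] at this
    rw [← hkv]
    apply angle_lt_pi_div_two_of_inner_pos
    rw [real_inner_smul_left, real_inner_smul_right]
    exact mul_pos hc (mul_pos (inv_pos.2 (norm_pos_iff.2 (h.w_ne_zero k))) (hXw k))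

/-- Here X = b₁ n i + b₂ n j + b₃ n k, so the b's are its products with the generators and the y's
its products with the normals. -/
theorem isNiceTriangle_of_coeffs (h : IsDualPair W n w) (hn : ∀ i, ‖n i‖ = 1)
    (hcard : Fintype.card ι = 3) {i j k : ι} (hij : i ≠ j) (hik : i ≠ k) (hjk : j ≠ k)
    {p q r b₁ b₂ b₃ y₁ y₂ y₃ : ℝ} (hp : ⟪n i, n j⟫ = p) (hq : ⟪n i, n k⟫ = q)
    (hr : ⟪n j, n k⟫ = r) (hb₁ : 0 < b₁) (hb₂ : 0 < b₂) (hb₃ : 0 < b₃)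
    (hy₁ : b₁ + p * b₂ + q * b₃ = y₁) (hy₂ : p * b₁ + b₂ + r * b₃ = y₂)
    (hy₃ : q * b₁ + r * b₂ + b₃ = y₃) (h₁ : 0 < y₁) (h₂ : 0 < y₂) (h₃ : 0 < y₃)
    (h₁₂ : y₁ * p < y₂) (h₂₁ : y₂ * p < y₁) (h₁₃ : y₁ * q < y₃) (h₃₁ : y₃ * q < y₁)
    (h₂₃ : y₂ * r < y₃) (h₃₂ : y₃ * r < y₂) :
    IsNiceTriangle (sphFace W n ∅) := by
  have hcov : ∀ x, x = i ∨ x = j ∨ x = k := by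
    have hc3 : ({i, j, k} : Finset ι).card = 3 := by
      rw [Finset.card_insert_of_notMem (by simp [hij, hik]), Finset.card_pair hjk]
    have := Finset.eq_univ_of_card _ (hc3.trans hcard.symm)
    intro x
    have hx := Finset.mem_univ x
    rw [← this] at hx
    simpa using hx
  have hp' : ⟪n j, n i⟫ = p := by rw [real_inner_comm, hp]
  have hq' : ⟪n k, n i⟫ = q := by rw [real_inner_comm, hq]
  have hr' : ⟪n k, n j⟫ = r := by rw [real_inner_comm, hr]
  have hs : ∀ x, ⟪n x, n x⟫ = 1 := fun x => by rw [real_inner_self_eq_norm_sq, hn, one_pow]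
  set X := b₁ • n i + b₂ • n j + b₃ • n k with hXdef
  have e : ∀ y, ⟪X, y⟫ = b₁ * ⟪n i, y⟫ + b₂ * ⟪n j, y⟫ + b₃ * ⟪n k, y⟫ := fun y => by
    simp only [hXdef, inner_add_left, real_inner_smul_left]
  have e₁ : ⟪X, n i⟫ = y₁ := by rw [e, hs, hp', hq', ← hy₁]; ring
  have e₂ : ⟪X, n j⟫ = y₂ := by rw [e, hs, hp, hr', ← hy₂]; ring
  have e₃ : ⟪X, n k⟫ = y₃ := by rw [e, hs, hq, hr, ← hy₃]; ring
  have hd := h.symm.inner_eq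
  refine h.isNiceTriangle hn hcard (X := X) ?_ ?_ ?_ ?_
  · exact W.add_mem (W.add_mem (W.smul_mem _ (h.n_mem _)) (W.smul_mem _ (h.n_mem _)))
      (W.smul_mem _ (h.n_mem _))
  · intro x
    rcases hcov x with rfl | rfl | rfl <;> simpa [e₁, e₂, e₃]
  · intro x
    rcases hcov x with rfl | rfl | rfl
    · simpa [e, hd, hij.symm, hik.symm] using hb₁
    · simpa [e, hd, hij, hjk.symm] using hb₂
    · simpa [e, hd, hik, hjk] using hb₃
  · intro x y hxy
    rcases hcov x with rfl | rfl | rfl <;> rcases hcov y with rfl | rfl | rfl <;>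
      first
      | exact absurd rfl hxy
      | simpa [e₁, e₂, e₃, hp, hq, hr, hp', hq', hr']

/-- If both products were non-negative, a second trial point, replacing the incenter, would make the
triangle nice. -/
theorem inner_neg_of_not_isNiceTriangle (h : IsDualPair W n w) (hn : ∀ i, ‖n i‖ = 1)
    (hcard : Fintype.card ι = 3) (hT : ¬ IsNiceTriangle (sphFace W n ∅)) {i j k : ι} (hij : i ≠ j)
    (hik : i ≠ k) (hjk : j ≠ k) (hle : 1 + ⟪n i, n j⟫ ≤ ⟪n i, n k⟫ + ⟪n j, n k⟫) :
    ⟪n i, n k⟫ < 0 ∨ ⟪n j, n k⟫ < 0 := by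
  by_contra! hcon
  obtain ⟨hq0, hr0⟩ := hcon
  refine hT ?_
  have hdet := h.symm.gram_three_pos hij hik hjk
  have hs : ∀ x, ⟪n x, n x⟫ = 1 := fun x => by rw [real_inner_self_eq_norm_sq, hn, one_pow]
  have hp1 := h.abs_inner_lt_one hn hij
  have hq1 := h.abs_inner_lt_one hn hik
  have hr1 := h.abs_inner_lt_one hn hjk
  simp only [hs] at hdet
  generalize hp : ⟪n i, n j⟫ = p at *
  generalize hq : ⟪n i, n k⟫ = q at *
  generalize hr : ⟪n j, n k⟫ = r at *
  -- A, B, m are the Gram entries of the projections of `n i`, `n j` to the complement of `n k`.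
  -- With coefficients B - m, A - m, 1 the foot of X on side k has the same product AB - m² with `n
  -- i` and `n j`.
  set A := 1 - q ^ 2 with hA
  set B := 1 - r ^ 2 with hB
  set m := p - q * r with hm
  have hA0 : 0 < A := by nlinarith
  have hB0 : 0 < B := by nlinarith
  have hpq : p < q := by linarith
  have hpr : p < r := by linarith
  have hAm : 0 < A - m := by
    rw [hA, hm]
    rcases le_total q r with hqr | hqr
    · nlinarith [mul_nonneg hq0 (sub_nonneg.2 hqr)]
    · nlinarith [mul_nonneg hq0 (sub_nonneg.2 hqr)]
  have hBm : 0 < B - m := by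
    rw [hB, hm]
    rcases le_total q r with hqr | hqr
    · nlinarith [mul_nonneg hr0 (sub_nonneg.2 hqr)]
    · nlinarith [mul_nonneg hr0 (sub_nonneg.2 hqr)]
  have hABm : 0 < A * B - m ^ 2 := by rw [hA, hB, hm]; nlinarith
  have hrpq : 0 ≤ r - p * q := by nlinarith [mul_nonneg hq0 hr0]
  have hqpr : 0 ≤ q - p * r := by nlinarith [mul_nonneg hq0 hr0]
  have hp2 : 0 < 1 - p ^ 2 := by nlinarith
  have h31 : q * (q * (B - m) + r * (A - m) + 1) < B - m + p * (A - m) + q * 1 := by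
    rw [hA, hB, hm] at *; nlinarith
  have h32 : r * (q * (B - m) + r * (A - m) + 1) < p * (B - m) + (A - m) + r * 1 := by
    rw [hA, hB, hm] at *; nlinarith
  have h3 : 0 < q * (B - m) + r * (A - m) + 1 := by positivity
  refine h.isNiceTriangle_of_coeffs hn hcard hij hik hjk hp hq hr hBm hAm one_pos rfl rfl rfl
    ((mul_nonneg hq0 h3.le).trans_lt h31) ((mul_nonneg hr0 h3.le).trans_lt h32) h3 ?_ ?_ ?_ ?_ ?_ ?_
  · nlinarith [mul_pos hAm hp2]
  · nlinarith [mul_pos hBm hp2]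
  · nlinarith [mul_nonneg hAm.le hrpq]
  · linarith
  · nlinarith [mul_nonneg hBm.le hqpr]
  · linarith

/-- The incenter of a spherical triangle which is not nice is too far from one of the vertices. -/
theorem exists_le_of_not_isNiceTriangle (h : IsDualPair W n w) (hn : ∀ i, ‖n i‖ = 1)
    (hcard : Fintype.card ι = 3) (hT : ¬ IsNiceTriangle (sphFace W n ∅)) {i j k : ι} (hij : i ≠ j)
    (hik : i ≠ k) (hjk : j ≠ k) :
    1 + ⟪n i, n j⟫ ≤ ⟪n i, n k⟫ + ⟪n j, n k⟫ ∨ 1 + ⟪n i, n k⟫ ≤ ⟪n i, n j⟫ + ⟪n j, n k⟫ ∨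
      1 + ⟪n j, n k⟫ ≤ ⟪n i, n j⟫ + ⟪n i, n k⟫ := by
  by_contra! hcon
  obtain ⟨h1, h2, h3⟩ := hcon
  refine hT ?_
  have hdet := h.symm.gram_three_pos hij hik hjk
  have hs : ∀ x, ⟪n x, n x⟫ = 1 := fun x => by rw [real_inner_self_eq_norm_sq, hn, one_pow]
  have hp1 := h.abs_inner_lt_one hn hij
  have hq1 := h.abs_inner_lt_one hn hik
  have hr1 := h.abs_inner_lt_one hn hjk
  simp only [hs] at hdet
  generalize hp : ⟪n i, n j⟫ = p at *
  generalize hq : ⟪n i, n k⟫ = q at *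
  generalize hr : ⟪n j, n k⟫ = r at *
  set d := 1 + 2 * p * q * r - p ^ 2 - q ^ 2 - r ^ 2 with hd
  have hd0 : 0 < d := by rw [hd]; linarith
  -- The coefficients are the adjugate of the Gram matrix applied to (1,1,1), so X has the same
  -- product `d`, the determinant, with all three normals.
  refine h.isNiceTriangle_of_coeffs hn hcard hij hik hjk hp hq hr
    (b₁ := (1 - r) * (1 + r - p - q)) (b₂ := (1 - q) * (1 + q - p - r))
    (b₃ := (1 - p) * (1 + p - q - r)) (y₁ := d) (y₂ := d) (y₃ := d)
    (mul_pos (by linarith) (by linarith)) (mul_pos (by linarith) (by linarith))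
    (mul_pos (by linarith) (by linarith)) (by rw [hd]; ring) (by rw [hd]; ring) (by rw [hd]; ring)
    hd0 hd0 hd0 ?_ ?_ ?_ ?_ ?_ ?_ <;> nlinarith

/-- The shape of a spherical triangle which is not nice. -/
theorem exists_shape_of_not_isNiceTriangle (h : IsDualPair W n w) (hn : ∀ i, ‖n i‖ = 1)
    (hcard : Fintype.card ι = 3) (hT : ¬ IsNiceTriangle (sphFace W n ∅)) :
    ∃ i j k : ι, i ≠ j ∧ i ≠ k ∧ j ≠ k ∧ 0 < ⟪n i, n k⟫ ∧ ⟪n j, n k⟫ < 0 ∧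
      1 + ⟪n i, n j⟫ ≤ ⟪n i, n k⟫ + ⟪n j, n k⟫ := by
  have key : ∀ i j k : ι, i ≠ j → i ≠ k → j ≠ k → 1 + ⟪n i, n j⟫ ≤ ⟪n i, n k⟫ + ⟪n j, n k⟫ →
      ∃ i j k : ι, i ≠ j ∧ i ≠ k ∧ j ≠ k ∧ 0 < ⟪n i, n k⟫ ∧ ⟪n j, n k⟫ < 0 ∧
        1 + ⟪n i, n j⟫ ≤ ⟪n i, n k⟫ + ⟪n j, n k⟫ := by
    intro i j k hij hik hjk hle
    have hp1 := h.abs_inner_lt_one hn hij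
    rcases h.inner_neg_of_not_isNiceTriangle hn hcard hT hij hik hjk hle with h1 | h1
    · refine ⟨j, i, k, hij.symm, hjk, hik, by linarith, h1, ?_⟩
      rw [real_inner_comm]
      linarith
    · exact ⟨i, j, k, hij, hik, hjk, by linarith, h1, hle⟩
  obtain ⟨i, j, k, hij, hik, hjk, -⟩ := Finset.card_eq_three.1 (Finset.card_univ.trans hcard)
  rcases h.exists_le_of_not_isNiceTriangle hn hcard hT hij hik hjk with h1 | h1 | h1
  · exact key i j k hij hik hjk h1
  · exact key i k j hik hij hjk.symm (by rwa [real_inner_comm (n j) (n k)])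
  · exact key j k i hjk hij.symm hik.symm
      (by rwa [real_inner_comm (n i) (n j), real_inner_comm (n i) (n k)])

end IsDualPair

end Triangle

end

/-! ### Real inequalities: coordinates of the good point. -/

section

open scoped Topology
open Filter

section Real

theorem eventually_pos_of_continuous {f : ℝ → ℝ} (hf : Continuous f) (h0 : 0 < f 0) :
    ∀ᶠ t in 𝓝[>] (0 : ℝ), 0 < f t :=
  nhdsWithin_le_nhds (hf.continuousAt.eventually (lt_mem_nhds h0))

/-- Coordinates of a point with two critical facets and three critical rays, when
`⟪u₁, u₂⟫` is positive. -/
theorem exists_coords_of_pos {a b c₀₂ c₀₃ c₁₂ c₁₃ U₀₁ U₀₂ U₀₃ U₁₁ U₁₂ U₁₃ U₂₂ U₂₃ U₃₃ : ℝ}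
    (ha : a < 1) (ha0 : 0 < a) (hb : b < 1) (hb0 : 0 < b) (h02 : 0 < c₀₂) (h02' : c₀₂ < 1)
    (ha02 : c₁₂ < a * c₀₂) (hb02 : c₀₃ < b * c₀₂) (hb12 : c₁₃ ≤ b * c₁₂)
    (hU11 : 0 < U₁₁) (hU22 : 0 < U₂₂) (hU33 : 0 < U₃₃) (hU12 : 0 < U₁₂) (hU13 : U₁₃ < 0)
    (hU23 : U₂₃ < 0) (hsq : U₁₂ ^ 2 < U₁₁ * U₂₂) (hm : U₀₁ * U₁₂ < U₀₂ * U₁₁)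
    (hc12 : c₁₂ * U₁₂ < U₂₂) (hrow : c₀₂ * U₀₂ + c₁₂ * U₁₂ < U₂₂) :
    ∃ α₀ α₁ α₂ α₃ : ℝ, 0 < α₀ ∧ 0 < α₁ ∧ 0 < α₂ ∧ 0 < α₃ ∧
      0 < α₀ + a * α₁ - c₀₂ * α₂ - c₀₃ * α₃ ∧ 0 < α₂ + b * α₃ - c₀₂ * α₀ - c₁₂ * α₁ ∧
      0 < α₁ * (1 - a ^ 2) + α₂ * (a * c₀₂ - c₁₂) + α₃ * (a * c₀₃ - c₁₃) ∧
      0 < α₀ * (b * c₀₂ - c₀₃) + α₁ * (b * c₁₂ - c₁₃) + α₃ * (1 - b ^ 2) ∧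
      (α₁ * U₀₁ < α₀ * U₁₁ ∧ α₁ * U₁₂ < α₂ * U₁₁ ∧ α₁ * U₁₃ < α₃ * U₁₁) ∧
      (α₂ * U₀₂ < α₀ * U₂₂ ∧ α₂ * U₁₂ < α₁ * U₂₂ ∧ α₂ * U₂₃ < α₃ * U₂₂) ∧
      (α₃ * U₀₃ < α₀ * U₃₃ ∧ α₃ * U₁₃ < α₁ * U₃₃ ∧ α₃ * U₂₃ < α₂ * U₃₃) := by
  have ha2 : 0 < 1 - a ^ 2 := by nlinarith
  have hb2 : 0 < 1 - b ^ 2 := by nlinarith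
  -- With α₂ = 1, ray 2 needs α₁ > U₁₂/U₂₂. So α₁ is taken just above this value, and the other
  -- strict inequalities survive.
  set z := U₁₂ / U₂₂ with hz
  have hzU : z * U₂₂ = U₁₂ := div_mul_cancel₀ _ hU22.ne'
  have hz0 : 0 < z := div_pos hU12 hU22
  obtain ⟨t, ht, e1, e2, e3, e4, e5⟩ : ∃ t > 0, 0 < U₁₁ - (z + t) * U₁₂ ∧ 0 < 1 - c₁₂ * (z + t) ∧
      0 < 1 - c₀₂ * (U₀₂ / U₂₂) - c₁₂ * (z + t) ∧
      0 < 1 - c₀₂ * ((z + t) * U₀₁ / U₁₁) - c₁₂ * (z + t) ∧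
      0 < 1 - c₀₂ * (c₀₂ - a * (z + t)) - c₁₂ * (z + t) := by
    have hzc : c₁₂ * z < 1 := by rw [hz, ← mul_div_assoc, div_lt_one hU22]; exact hc12
    have h3 : 0 < 1 - c₀₂ * (U₀₂ / U₂₂) - c₁₂ * z := by
      rw [hz, ← mul_div_assoc, ← mul_div_assoc, sub_sub, ← add_div, sub_pos, div_lt_one hU22]
      exact hrow
    have hlt : z * U₀₁ / U₁₁ < U₀₂ / U₂₂ := by
      rw [div_lt_div_iff₀ hU11 hU22, mul_right_comm, hzU]
      linarith
    have E1 := eventually_pos_of_continuous (f := fun t => U₁₁ - (z + t) * U₁₂) (by fun_prop) (by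
      rw [add_zero, hz, div_mul_eq_mul_div, sub_pos, div_lt_iff₀ hU22]; linarith)
    have E2 := eventually_pos_of_continuous (f := fun t => 1 - c₁₂ * (z + t)) (by fun_prop) (by
      rw [add_zero]; linarith)
    have E3 := eventually_pos_of_continuous
      (f := fun t => 1 - c₀₂ * (U₀₂ / U₂₂) - c₁₂ * (z + t)) (by fun_prop) (by
      rw [add_zero]; exact h3)
    have E4 := eventually_pos_of_continuous
      (f := fun t => 1 - c₀₂ * ((z + t) * U₀₁ / U₁₁) - c₁₂ * (z + t)) (by fun_prop) (by
      rw [add_zero]; nlinarith)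
    have E5 := eventually_pos_of_continuous
      (f := fun t => 1 - c₀₂ * (c₀₂ - a * (z + t)) - c₁₂ * (z + t)) (by fun_prop) (by
      rw [add_zero]; nlinarith)
    obtain ⟨t, h1, h2, h3, h4, h5, h6⟩ :=
      (E1.and (E2.and (E3.and (E4.and (E5.and self_mem_nhdsWithin))))).exists
    exact ⟨t, h6, h1, h2, h3, h4, h5⟩
  set α₁ := z + t with hα₁
  have hα₁0 : 0 < α₁ := by positivity
  -- The lower bounds come from positivity, ray 2, ray 1 and ⟪Y, n 0⟫ > 0; the upper bound comes
  -- from ⟪Y, n 2⟫ > 0.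
  obtain ⟨α₀, hl, hr⟩ : ∃ α₀, max (max 0 (U₀₂ / U₂₂)) (max (α₁ * U₀₁ / U₁₁) (c₀₂ - a * α₁)) < α₀ ∧
      α₀ < (1 - c₁₂ * α₁) / c₀₂ := by
    refine exists_between ?_
    refine max_lt (max_lt ?_ ?_) (max_lt ?_ ?_) <;> rw [lt_div_iff₀ h02] <;> linarith
  simp only [max_lt_iff, div_lt_iff₀ hU22, div_lt_iff₀ hU11] at hl
  rw [lt_div_iff₀ h02] at hr
  obtain ⟨⟨hl1, hl2⟩, hl3, hl4⟩ := hl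
  -- The last coordinate α₃ = s is infinitesimal: the conditions perturbed here are already strict
  -- at s = 0.
  have E1 := eventually_pos_of_continuous
    (f := fun s => α₀ + a * α₁ - c₀₂ * 1 - c₀₃ * s) (by fun_prop) (by linarith)
  have E2 := eventually_pos_of_continuous
    (f := fun s => α₁ * (1 - a ^ 2) + 1 * (a * c₀₂ - c₁₂) + s * (a * c₀₃ - c₁₃)) (by fun_prop)
    (by linarith [mul_pos hα₁0 ha2])
  have E3 := eventually_pos_of_continuous (f := fun s => α₀ * U₃₃ - s * U₀₃) (by fun_prop)
    (by rw [zero_mul, sub_zero]; positivity)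
  obtain ⟨s, h1, h2, h3, hs⟩ := (E1.and (E2.and (E3.and self_mem_nhdsWithin))).exists
  have hs : 0 < s := hs
  refine ⟨α₀, α₁, 1, s, hl1, hα₁0, one_pos, hs, h1, by linarith [mul_pos hb0 hs], h2, ?_, ⟨hl3, by linarith, ?_⟩,
    ⟨by linarith, ?_, ?_⟩, by linarith, ?_, ?_⟩
  · have := mul_pos hl1 (sub_pos.2 hb02)
    have := mul_nonneg hα₁0.le (sub_nonneg.2 hb12)
    have := mul_pos hs hb2
    linarith
  · linarith [mul_pos hs hU11, mul_neg_of_pos_of_neg hα₁0 hU13]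
  · rw [hα₁, add_mul, hzU]
    linarith [mul_pos ht hU22]
  · linarith [mul_pos hs hU22]
  · linarith [mul_pos hα₁0 hU33, mul_neg_of_pos_of_neg hs hU13]
  · linarith [mul_neg_of_pos_of_neg hs hU23]

/-- Coordinates of a point with two critical facets and three critical rays, when `⟪u₁, u₂⟫` and
`⟪u₂, u₃⟫` are not positive. -/
theorem exists_coords_of_nonpos {a b c₀₂ c₀₃ c₁₂ c₁₃ U₀₁ U₀₂ U₀₃ U₁₁ U₁₂ U₁₃ U₂₂ U₂₃ U₃₃ : ℝ}
    (h02 : 0 < c₀₂) (h02' : c₀₂ < 1) (ha02 : c₁₂ < a * c₀₂) (hb02 : c₀₃ < b * c₀₂)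
    (hU11 : 0 < U₁₁) (hU22 : 0 < U₂₂) (hU33 : 0 < U₃₃) (hU12 : U₁₂ ≤ 0)
    (hU23 : U₂₃ ≤ 0) (hsq : U₁₃ ^ 2 < U₁₁ * U₃₃) (hrow : c₀₂ * U₀₂ < U₂₂) :
    ∃ α₀ α₁ α₂ α₃ : ℝ, 0 < α₀ ∧ 0 < α₁ ∧ 0 < α₂ ∧ 0 < α₃ ∧
      0 < α₀ + a * α₁ - c₀₂ * α₂ - c₀₃ * α₃ ∧ 0 < α₂ + b * α₃ - c₀₂ * α₀ - c₁₂ * α₁ ∧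
      0 < α₁ * (1 - a ^ 2) + α₂ * (a * c₀₂ - c₁₂) + α₃ * (a * c₀₃ - c₁₃) ∧
      0 < α₀ * (b * c₀₂ - c₀₃) + α₁ * (b * c₁₂ - c₁₃) + α₃ * (1 - b ^ 2) ∧
      (α₁ * U₀₁ < α₀ * U₁₁ ∧ α₁ * U₁₂ < α₂ * U₁₁ ∧ α₁ * U₁₃ < α₃ * U₁₁) ∧
      (α₂ * U₀₂ < α₀ * U₂₂ ∧ α₂ * U₁₂ < α₁ * U₂₂ ∧ α₂ * U₂₃ < α₃ * U₂₂) ∧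
      (α₃ * U₀₃ < α₀ * U₃₃ ∧ α₃ * U₁₃ < α₁ * U₃₃ ∧ α₃ * U₂₃ < α₂ * U₃₃) := by
  -- Y is taken close to the plane of `n 0`, `n 2`: α₀ = 1, α₂ = t, the others infinitesimal. The
  -- bounds on t are ⟪Y, n 2⟫ > 0, ⟪Y, n 0⟫ > 0 and ray 2 in the limit; t just above c₀₂ satisfies
  -- them.
  obtain ⟨t, ht1, ht2, ht3⟩ : ∃ t, c₀₂ < t ∧ c₀₂ * t < 1 ∧ t * U₀₂ < U₂₂ := by
    have E1 := eventually_pos_of_continuous (f := fun s => 1 - c₀₂ * (c₀₂ + s)) (by fun_prop)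
      (by nlinarith)
    have E2 := eventually_pos_of_continuous (f := fun s => U₂₂ - (c₀₂ + s) * U₀₂) (by fun_prop)
      (by linarith)
    obtain ⟨s, h1, h2, hs⟩ := (E1.and (E2.and self_mem_nhdsWithin)).exists
    have hs : 0 < s := hs
    exact ⟨c₀₂ + s, by linarith, by linarith, by linarith⟩
  have ht0 : 0 < t := h02.trans ht1
  -- The ratio of the two small coordinates must suit rays 1 and 3 against each other; strict
  -- Cauchy–Schwarz leaves room.
  obtain ⟨p, q, hp, hq, hpq, hqp⟩ : ∃ p q, 0 < p ∧ 0 < q ∧ p * U₁₃ < q * U₁₁ ∧ q * U₁₃ < p * U₃₃ := by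
    rcases le_total U₁₃ 0 with h | h
    · exact ⟨1, 1, one_pos, one_pos, by linarith, by linarith⟩
    · exact ⟨U₁₁ + U₁₃, U₃₃ + U₁₃, by linarith, by linarith, by nlinarith, by nlinarith⟩
  have E1 := eventually_pos_of_continuous
    (f := fun s => 1 + a * (s * p) - c₀₂ * t - c₀₃ * (s * q)) (by fun_prop) (by simpa using ht2)
  have E2 := eventually_pos_of_continuous
    (f := fun s => t + b * (s * q) - c₀₂ * 1 - c₁₂ * (s * p)) (by fun_prop) (by simpa using ht1)
  have E3 := eventually_pos_of_continuous
    (f := fun s => s * p * (1 - a ^ 2) + t * (a * c₀₂ - c₁₂) + s * q * (a * c₀₃ - c₁₃))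
    (by fun_prop) (by simpa [ht0] using ha02)
  have E4 := eventually_pos_of_continuous
    (f := fun s => 1 * (b * c₀₂ - c₀₃) + s * p * (b * c₁₂ - c₁₃) + s * q * (1 - b ^ 2))
    (by fun_prop) (by simpa using hb02)
  have E5 := eventually_pos_of_continuous (f := fun s => 1 * U₁₁ - s * p * U₀₁) (by fun_prop)
    (by simpa using hU11)
  have E6 := eventually_pos_of_continuous (f := fun s => 1 * U₃₃ - s * q * U₀₃) (by fun_prop)
    (by simpa using hU33)
  obtain ⟨s, h1, h2, h3, h4, h5, h6, hs⟩ :=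
    (E1.and (E2.and (E3.and (E4.and (E5.and (E6.and self_mem_nhdsWithin)))))).exists
  have hs : 0 < s := hs
  have hsp := mul_pos hs hp
  have hsq := mul_pos hs hq
  refine ⟨1, s * p, t, s * q, one_pos, hsp, ht0, hsq, h1, h2, h3, h4,
    ⟨by linarith, ?_, ?_⟩, ⟨by linarith, ?_, ?_⟩, by linarith, ?_, ?_⟩
  · linarith [mul_pos ht0 hU11, mul_nonpos_of_nonneg_of_nonpos hsp.le hU12]
  · linarith [mul_lt_mul_of_pos_left hpq hs]
  · linarith [mul_pos hsp hU22, mul_nonpos_of_nonneg_of_nonpos ht0.le hU12]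
  · linarith [mul_pos hsq hU22, mul_nonpos_of_nonneg_of_nonpos ht0.le hU23]
  · linarith [mul_lt_mul_of_pos_left hqp hs]
  · linarith [mul_pos ht0 hU33, mul_nonpos_of_nonneg_of_nonpos hsq.le hU23]

end Real

end

/-! ### Good points and Jacobi's identity for the two Gram matrices. -/

section

set_option linter.unusedSimpArgs false




/-- A point `Y` inside the simplicial cone with unit normals `n` and generators `u` that has two
critical facets and three critical rays, together with what is needed to find three critical
two-dimensional faces. -/
structure IsGoodPoint (n u : Fin 4 → E) (Y : E) : Prop where
  neg_02 : ⟪n 0, n 2⟫ < 0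
  neg_03 : ⟪n 0, n 3⟫ < 0
  neg_12 : ⟪n 1, n 2⟫ < 0
  neg_13 : ⟪n 1, n 3⟫ < 0
  n_pos : ∀ i, 0 < ⟪Y, n i⟫
  u_pos : ∀ i, 0 < ⟪Y, u i⟫
  facet_0 : ⟪Y, n 0⟫ * ⟪n 0, n 1⟫ < ⟪Y, n 1⟫
  facet_2 : ⟪Y, n 2⟫ * ⟪n 2, n 3⟫ < ⟪Y, n 3⟫
  ray : ∀ l, l ≠ 0 → ∀ j, l ≠ j → ⟪Y, u l⟫ * ⟪u l, u j⟫ < ⟪Y, u j⟫ * ⟪u l, u l⟫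
  third : ⟪Y, u 0⟫ * ⟪u 0, u 2⟫ < ⟪Y, u 2⟫ * ⟪u 0, u 0⟫ ∨
    ⟪Y, u 0⟫ * ⟪u 0, u 3⟫ < ⟪Y, u 3⟫ * ⟪u 0, u 0⟫ ∨
    ⟪Y, n 1⟫ * ⟪n 0, n 1⟫ ≤ ⟪Y, n 0⟫

namespace IsDualPair

/-- The Gram matrices of dual bases are inverse to each other. -/
theorem gram_mul {ι : Type*} [Fintype ι] [DecidableEq ι] {W : Submodule ℝ E} {n u : ι → E}
    (h : IsDualPair W n u) (i k : ι) :
    ∑ j, ⟪n i, n j⟫ * ⟪u j, u k⟫ = if i = k then 1 else 0 := by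
  rw [← h.inner_expand (h.n_mem i), real_inner_comm, h.inner_eq]
  simp [eq_comm]

theorem sq_inner_lt_mul {ι : Type*} [Fintype ι] [DecidableEq ι] {W : Submodule ℝ E} {n u : ι → E}
    (h : IsDualPair W n u) {i j : ι} (hij : i ≠ j) :
    ⟪u i, u j⟫ ^ 2 < ⟪u i, u i⟫ * ⟪u j, u j⟫ := by
  have h0 : ⟪u j, u j⟫ • u i - ⟪u i, u j⟫ • u j ≠ 0 := fun h0 => by
    have := congrArg (fun x => ⟪x, n i⟫) h0
    simp [inner_sub_left, real_inner_smul_left, h.inner_eq, hij.symm, h.w_ne_zero j] at this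
  have h1 := real_inner_self_pos.2 h0
  have hj := real_inner_self_pos.2 (h.w_ne_zero j)
  simp only [inner_sub_left, inner_sub_right, real_inner_smul_left, real_inner_smul_right,
    real_inner_comm (u i) (u j)] at h1
  nlinarith

variable {W : Submodule ℝ E} {n u : Fin 4 → E}

theorem comp_perm (h : IsDualPair W n u) (σ : Equiv.Perm (Fin 4)) :
    IsDualPair W (n ∘ σ) (u ∘ σ) where
  inner_eq i j := by simp [h.inner_eq]
  n_mem i := h.n_mem _
  w_mem i := h.w_mem _
  expand x hx := by
    conv_lhs => rw [h.expand x hx]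
    exact (Equiv.sum_comp σ fun i => ⟪x, n i⟫ • u i).symm

/-- Jacobi's identity for the complementary minors of the Gram matrices of the normals and of the
generators. -/
theorem gram_minor (h : IsDualPair W n u) {i j k l : Fin 4} (hij : i ≠ j) (hik : i ≠ k)
    (hil : i ≠ l) (hjk : j ≠ k) (hjl : j ≠ l) (hkl : k ≠ l) (hl : ‖n l‖ = 1) :
    (⟪n i, n j⟫ - ⟪n i, n l⟫ * ⟪n j, n l⟫) *
      (⟪u i, u i⟫ * ⟪u j, u j⟫ * ⟪u k, u k⟫ + 2 * ⟪u i, u j⟫ * ⟪u i, u k⟫ * ⟪u j, u k⟫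
        - ⟪u i, u i⟫ * ⟪u j, u k⟫ ^ 2 - ⟪u j, u j⟫ * ⟪u i, u k⟫ ^ 2
        - ⟪u k, u k⟫ * ⟪u i, u j⟫ ^ 2) =
      ⟪u i, u k⟫ * ⟪u j, u k⟫ - ⟪u i, u j⟫ * ⟪u k, u k⟫ := by
  have hsum : ∀ f : Fin 4 → ℝ, ∑ x, f x = f i + f j + f k + f l := by
    intro f
    have hc : ({i, j, k, l} : Finset (Fin 4)).card = 4 := by
      rw [Finset.card_insert_of_notMem (by simp [hij, hik, hil]),
        Finset.card_insert_of_notMem (by simp [hjk, hjl]), Finset.card_pair hkl]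
    rw [← Finset.eq_univ_of_card _ (hc.trans (Fintype.card_fin 4).symm),
      Finset.sum_insert (by simp [hij, hik, hil]), Finset.sum_insert (by simp [hjk, hjl]),
      Finset.sum_pair hkl]
    ring
  have hnl : ⟪n l, n l⟫ = 1 := by rw [real_inner_self_eq_norm_sq, hl, one_pow]
  have e := fun y => h.gram_mul i y
  have e' := fun y => h.gram_mul l y
  simp only [hsum] at e e'
  have e1 := e i
  have e2 := e j
  have e3 := e k
  have f1 := e' i
  have f2 := e' j
  have f3 := e' k
  simp only [hij, hik, hil.symm, hjl.symm, hkl.symm, if_true, if_false, hnl,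
    real_inner_comm (n i) (n l), real_inner_comm (n j) (n l),
    real_inner_comm (u i) (u j), real_inner_comm (u i) (u k), real_inner_comm (u j) (u k)]
    at e1 e2 e3 f1 f2 f3
  -- Subtracting ⟪n i, n l⟫ times row l removes the terms in `u l`. The multipliers are the
  -- cofactors of column j in the Gram matrix of `u i`, `u j`, `u k`.
  linear_combination (⟪u i, u k⟫ * ⟪u j, u k⟫ - ⟪u i, u j⟫ * ⟪u k, u k⟫) *
      (e1 - ⟪n i, n l⟫ * f1) +
    (⟪u i, u i⟫ * ⟪u k, u k⟫ - ⟪u i, u k⟫ ^ 2) * (e2 - ⟪n i, n l⟫ * f2) +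
    (⟪u i, u j⟫ * ⟪u i, u k⟫ - ⟪u i, u i⟫ * ⟪u j, u k⟫) * (e3 - ⟪n i, n l⟫ * f3)

/-- The three-by-three Gram determinant in `gram_minor` is positive, so a comparison of normals
fixes the sign of a minor for the generators. -/
theorem minor_neg (h : IsDualPair W n u) {i j k l : Fin 4} (hl : ‖n l‖ = 1)
    (hlt : ⟪n i, n j⟫ < ⟪n i, n l⟫ * ⟪n j, n l⟫)
    (hd : i ≠ j ∧ i ≠ k ∧ i ≠ l ∧ j ≠ k ∧ j ≠ l ∧ k ≠ l := by decide) :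
    ⟪u i, u k⟫ * ⟪u j, u k⟫ < ⟪u i, u j⟫ * ⟪u k, u k⟫ := by
  obtain ⟨hij, hik, hil, hjk, hjl, hkl⟩ := hd
  rw [← sub_neg, ← h.gram_minor hij hik hil hjk hjl hkl hl]
  exact mul_neg_of_neg_of_pos (sub_neg.2 hlt) (h.gram_three_pos hij hik hjk)

theorem minor_pos (h : IsDualPair W n u) {i j k l : Fin 4} (hl : ‖n l‖ = 1)
    (hlt : ⟪n i, n l⟫ * ⟪n j, n l⟫ < ⟪n i, n j⟫)
    (hd : i ≠ j ∧ i ≠ k ∧ i ≠ l ∧ j ≠ k ∧ j ≠ l ∧ k ≠ l := by decide) :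
    ⟪u i, u j⟫ * ⟪u k, u k⟫ < ⟪u i, u k⟫ * ⟪u j, u k⟫ := by
  obtain ⟨hij, hik, hil, hjk, hjl, hkl⟩ := hd
  rw [← sub_pos, ← h.gram_minor hij hik hil hjk hjl hkl hl]
  exact mul_pos (sub_pos.2 hlt) (h.gram_three_pos hij hik hjk)

/-- For Y = Σ αᵢ n i the coordinates are αᵢ = ⟪Y, u i⟫, and `hα` is the list of facet and ray
conditions in these terms; `hthird` serves only the third two-dimensional face. -/
theorem exists_isGoodPoint_of_coords (h : IsDualPair W n u) (hn : ∀ i, ‖n i‖ = 1)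
    (h02 : ⟪n 0, n 2⟫ < 0) (h03 : ⟪n 0, n 3⟫ < 0) (h12 : ⟪n 1, n 2⟫ < 0) (h13 : ⟪n 1, n 3⟫ < 0)
    (h01 : 0 < ⟪n 0, n 1⟫) (h23 : 0 < ⟪n 2, n 3⟫)
    (hα : ∃ α₀ α₁ α₂ α₃ : ℝ, 0 < α₀ ∧ 0 < α₁ ∧ 0 < α₂ ∧ 0 < α₃ ∧
      0 < α₀ + ⟪n 0, n 1⟫ * α₁ - -⟪n 0, n 2⟫ * α₂ - -⟪n 0, n 3⟫ * α₃ ∧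
      0 < α₂ + ⟪n 2, n 3⟫ * α₃ - -⟪n 0, n 2⟫ * α₀ - -⟪n 1, n 2⟫ * α₁ ∧
      0 < α₁ * (1 - ⟪n 0, n 1⟫ ^ 2) + α₂ * (⟪n 0, n 1⟫ * -⟪n 0, n 2⟫ - -⟪n 1, n 2⟫) +
        α₃ * (⟪n 0, n 1⟫ * -⟪n 0, n 3⟫ - -⟪n 1, n 3⟫) ∧
      0 < α₀ * (⟪n 2, n 3⟫ * -⟪n 0, n 2⟫ - -⟪n 0, n 3⟫) +
        α₁ * (⟪n 2, n 3⟫ * -⟪n 1, n 2⟫ - -⟪n 1, n 3⟫) + α₃ * (1 - ⟪n 2, n 3⟫ ^ 2) ∧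
      (α₁ * ⟪u 0, u 1⟫ < α₀ * ⟪u 1, u 1⟫ ∧ α₁ * ⟪u 1, u 2⟫ < α₂ * ⟪u 1, u 1⟫ ∧
        α₁ * ⟪u 1, u 3⟫ < α₃ * ⟪u 1, u 1⟫) ∧
      (α₂ * ⟪u 0, u 2⟫ < α₀ * ⟪u 2, u 2⟫ ∧ α₂ * ⟪u 1, u 2⟫ < α₁ * ⟪u 2, u 2⟫ ∧
        α₂ * ⟪u 2, u 3⟫ < α₃ * ⟪u 2, u 2⟫) ∧
      (α₃ * ⟪u 0, u 3⟫ < α₀ * ⟪u 3, u 3⟫ ∧ α₃ * ⟪u 1, u 3⟫ < α₁ * ⟪u 3, u 3⟫ ∧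
        α₃ * ⟪u 2, u 3⟫ < α₂ * ⟪u 3, u 3⟫))
    (hthird : ⟪u 0, u 3⟫ ≤ 0 ∨
      -⟪n 1, n 2⟫ * ⟪n 0, n 1⟫ ≤ -⟪n 0, n 2⟫ ∧ -⟪n 1, n 3⟫ * ⟪n 0, n 1⟫ ≤ -⟪n 0, n 3⟫) :
    ∃ Y ∈ W, IsGoodPoint n u Y := by
  obtain ⟨α₀, α₁, α₂, α₃, p0, p1, p2, p3, y0, y2, f0, f2, ⟨m10, m12, m13⟩, ⟨m20, m21, m23⟩,
    m30, m31, m32⟩ := hα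
  have hs : ∀ x, ⟪n x, n x⟫ = 1 := fun x => by rw [real_inner_self_eq_norm_sq, hn, one_pow]
  set Y := α₀ • n 0 + α₁ • n 1 + α₂ • n 2 + α₃ • n 3 with hY
  have e : ∀ y, ⟪Y, y⟫ = α₀ * ⟪n 0, y⟫ + α₁ * ⟪n 1, y⟫ + α₂ * ⟪n 2, y⟫ + α₃ * ⟪n 3, y⟫ :=
    fun y => by simp only [hY, inner_add_left, real_inner_smul_left]
  have hd := h.symm.inner_eq
  have u0 : ⟪Y, u 0⟫ = α₀ := by simp [e, hd]
  have u1 : ⟪Y, u 1⟫ = α₁ := by simp [e, hd]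
  have u2 : ⟪Y, u 2⟫ = α₂ := by simp [e, hd]
  have u3 : ⟪Y, u 3⟫ = α₃ := by simp [e, hd]
  have c01 := real_inner_comm (n 0) (n 1)
  have c02 := real_inner_comm (n 0) (n 2)
  have c03 := real_inner_comm (n 0) (n 3)
  have c12 := real_inner_comm (n 1) (n 2)
  have c13 := real_inner_comm (n 1) (n 3)
  have c23 := real_inner_comm (n 2) (n 3)
  have g0 : ⟪Y, n 0⟫ * ⟪n 0, n 1⟫ < ⟪Y, n 1⟫ := by
    simp only [e, hs, c01, c02, c03, c12, c13, c23]; linarith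
  have g2 : ⟪Y, n 2⟫ * ⟪n 2, n 3⟫ < ⟪Y, n 3⟫ := by
    simp only [e, hs, c01, c02, c03, c12, c13, c23]; linarith
  have z0 : 0 < ⟪Y, n 0⟫ := by
    simp only [e, hs, c01, c02, c03, c12, c13, c23]; linarith
  have z2 : 0 < ⟪Y, n 2⟫ := by
    simp only [e, hs, c01, c02, c03, c12, c13, c23]; linarith
  have hYW : Y ∈ W := by
    rw [hY]
    exact W.add_mem (W.add_mem (W.add_mem (W.smul_mem _ (h.n_mem _)) (W.smul_mem _ (h.n_mem _)))
      (W.smul_mem _ (h.n_mem _))) (W.smul_mem _ (h.n_mem _))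
  refine ⟨Y, hYW, h02, h03, h12, h13, ?_, ?_, g0, g2, ?_, ?_⟩
  · intro i
    fin_cases i
    · exact z0
    · exact (mul_pos z0 h01).trans g0
    · exact z2
    · exact (mul_pos z2 h23).trans g2
  · intro i
    fin_cases i
    · exact u0.symm ▸ p0
    · exact u1.symm ▸ p1
    · exact u2.symm ▸ p2
    · exact u3.symm ▸ p3
  · have d01 := real_inner_comm (u 0) (u 1)
    have d02 := real_inner_comm (u 0) (u 2)
    have d03 := real_inner_comm (u 0) (u 3)
    have d12 := real_inner_comm (u 1) (u 2)
    have d13 := real_inner_comm (u 1) (u 3)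
    have d23 := real_inner_comm (u 2) (u 3)
    intro l hl j hlj
    fin_cases l <;> fin_cases j <;>
      first
      | exact absurd rfl hl
      | exact absurd rfl hlj
      | (simp only [Fin.zero_eta, Fin.mk_one, Fin.reduceFinMk, u0, u1, u2, u3, d01, d02, d03, d12,
          d13, d23]; assumption)
  · have hU := real_inner_self_pos.2 (h.w_ne_zero 0)
    rcases hthird with h0 | ⟨ha, hb⟩
    · right; left
      rw [u0, u3]
      exact (mul_nonpos_of_nonneg_of_nonpos p0.le h0).trans_lt (mul_pos p3 hU)
    · by_contra! hcon
      obtain ⟨k1, k2, k3⟩ := hcon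
      rw [u0, u2] at k1
      rw [u0, u3] at k2
      have r0 := h.gram_mul 0 0
      have r1 := h.gram_mul 1 0
      simp only [Fin.sum_univ_four, hs, c01, c02, c03, c12, c13, c23, if_true, one_mul,
        real_inner_comm (u 0)] at r0 r1
      rw [if_neg (by decide)] at r1
      simp only [e, hs, c01, c02, c03, c12, c13, c23] at k3
      have q1 := mul_nonneg (sub_nonneg.2 k1) (sub_nonneg.2 ha)
      have q2 := mul_nonneg (sub_nonneg.2 k2) (sub_nonneg.2 hb)
      have q3 := mul_pos (sub_pos.2 k3) hU
      -- If all three alternatives failed, row 0 of the inverse-matrix identity minus ⟪n 0, n 1⟫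
      -- times row 1 would leave no room for α₀ > 0.
      have : α₀ ≤ 0 := by
        linear_combination q1 + q2 + q3 - α₀ * r0 + α₀ * ⟪n 0, n 1⟫ * r1
      exact this.not_gt p0

end IsDualPair

end

/-! ### Signs of the products of the generators. -/

section

set_option linter.unusedSimpArgs false



section Real

/-- Multiply the two inequalities and cancel xy. It is applied with p = q, where the conclusion
contradicts strict Cauchy–Schwarz; all sign lemmas below rest on this. -/
theorem lt_of_mul_lt_of_sq_lt {x y p q A B : ℝ} (hx : 0 < x) (hp : x * A < y * p)
    (hq : y * B < x * q) (hqB : 0 ≤ q) (hA : 0 < A) (hy : 0 < y) (hB : 0 < B) : A * B < p * q := by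
  have h1 : x * A * (y * B) < y * p * (x * q) :=
    mul_lt_mul'' hp hq (by positivity) (by positivity)
  have h2 : 0 < x * y := mul_pos hx hy
  nlinarith

theorem neg_of_pos_of_minors {U₁₂ U₁₃ U₂₃ U₂₂ U₃₃ : ℝ} (h22 : 0 < U₂₂) (h33 : 0 < U₃₃)
    (hsq : U₂₃ ^ 2 < U₂₂ * U₃₃) (h6 : U₁₂ * U₃₃ < U₁₃ * U₂₃) (h7 : U₁₃ * U₂₂ < U₁₂ * U₂₃)
    (h12 : 0 < U₁₂) : U₁₃ < 0 ∧ U₂₃ < 0 := by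
  have h0 : 0 < U₁₃ * U₂₃ := (mul_pos h12 h33).trans h6
  rcases pos_and_pos_or_neg_and_neg_of_mul_pos h0 with ⟨h13, h23⟩ | h
  · have := lt_of_mul_lt_of_sq_lt h12 h6 h7 h23.le h33 h13 h22
    nlinarith
  · exact h

theorem nonpos_of_minors {U₀₁ U₀₂ U₁₂ U₀₀ U₁₁ U₂₂ : ℝ} (h00 : 0 < U₀₀) (h11 : 0 < U₁₁)
    (h22 : 0 < U₂₂) (hsq : U₀₁ ^ 2 < U₀₀ * U₁₁) (h1 : U₀₁ * U₁₂ < U₀₂ * U₁₁)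
    (h5 : U₀₁ * U₀₂ < U₁₂ * U₀₀) (h10 : U₀₁ * U₂₂ < U₀₂ * U₁₂) (h12 : U₁₂ ≤ 0) : U₀₁ ≤ 0 := by
  by_contra! h01
  have h0 : 0 < U₀₂ * U₁₂ := (mul_pos h01 h22).trans h10
  rcases pos_and_pos_or_neg_and_neg_of_mul_pos h0 with ⟨-, h⟩ | ⟨h02, h12'⟩
  · exact h12.not_gt h
  · have := lt_of_mul_lt_of_sq_lt (x := -U₀₂) (y := -U₁₂) (p := U₀₁) (q := U₀₁) (A := U₁₁) (B := U₀₀)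
      (by linarith) (by linarith) (by linarith) h01.le h11 (by linarith) h00
    nlinarith

theorem signs_of_minors {U₀₁ U₀₂ U₁₂ U₀₀ U₁₁ U₂₂ : ℝ} (h00 : 0 < U₀₀) (h11 : 0 < U₁₁)
    (h22 : 0 < U₂₂) (hsq01 : U₀₁ ^ 2 < U₀₀ * U₁₁) (hsq02 : U₀₂ ^ 2 < U₀₀ * U₂₂)
    (hsq12 : U₁₂ ^ 2 < U₁₁ * U₂₂) (h1 : U₀₁ * U₁₂ < U₀₂ * U₁₁)
    (h5 : U₁₂ * U₀₀ < U₀₁ * U₀₂) (h10 : U₀₁ * U₂₂ < U₀₂ * U₁₂) : U₀₁ < 0 ∧ U₁₂ < 0 ∧ 0 < U₀₂ := by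
  have h02 : 0 < U₀₂ := by
    by_contra! hle
    have hA : U₀₁ * U₁₂ < 0 := h1.trans_le (mul_nonpos_of_nonpos_of_nonneg hle h11.le)
    rcases lt_or_ge 0 U₁₂ with h12 | h12
    · have h01 : U₀₁ < 0 := neg_of_mul_neg_left hA h12.le
      rcases hle.lt_or_eq with hlt | heq
      · have := lt_of_mul_lt_of_sq_lt (x := -U₀₂) (y := U₁₂) (p := -U₀₁) (q := -U₀₁) (A := U₁₁)
          (B := U₀₀) (by linarith) (by linarith) (by linarith) (by linarith) h11 h12 h00
        nlinarith
      · rw [heq] at h5; nlinarith [mul_pos h12 h00]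
    · have h01 : 0 < U₀₁ := by
        by_contra! h
        nlinarith [mul_nonneg_of_nonpos_of_nonpos h h12]
      rcases hle.lt_or_eq with hlt | heq
      · have h12' : U₁₂ < 0 := by
          refine h12.lt_of_ne fun h => ?_
          rw [h] at hA; linarith
        have := lt_of_mul_lt_of_sq_lt (x := U₀₁) (y := -U₀₂) (p := -U₁₂) (q := -U₁₂) (A := U₂₂)
          (B := U₁₁) h01 (by linarith) (by linarith) (by linarith) h22 (by linarith) h11
        nlinarith
      · rw [heq] at h10; nlinarith [mul_pos h01 h22]
  have h01 : U₀₁ < 0 := by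
    by_contra! h
    have h12 : 0 < U₁₂ := by
      refine pos_of_mul_pos_right ((mul_nonneg h h22.le).trans_lt h10) h02.le
    have h01 : 0 < U₀₁ := pos_of_mul_pos_left ((mul_pos h12 h00).trans h5) h02.le
    have := lt_of_mul_lt_of_sq_lt (x := U₁₂) (y := U₀₁) (p := U₀₂) (q := U₀₂) (A := U₀₀)
      (B := U₂₂) h12 h5 (by linarith) h02.le h00 h01 h22
    nlinarith
  refine ⟨h01, ?_, h02⟩
  have : U₁₂ * U₀₀ < 0 := h5.trans (mul_neg_of_neg_of_pos h01 h02)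
  exact neg_of_mul_neg_left this h00.le

theorem neg_of_neg_of_minors {U₀₁ U₀₃ U₁₃ U₀₀ U₁₁ : ℝ} (h00 : 0 < U₀₀) (h11 : 0 < U₁₁)
    (hsq : U₀₁ ^ 2 < U₀₀ * U₁₁) (h4 : U₀₃ * U₁₁ < U₀₁ * U₁₃) (h8 : U₀₁ * U₀₃ < U₁₃ * U₀₀)
    (h01 : U₀₁ < 0) : U₀₃ < 0 := by
  by_contra! h
  have h0 : 0 < U₀₁ * U₁₃ := (mul_nonneg h h11.le).trans_lt h4
  have h13 : U₁₃ < 0 := neg_of_mul_pos_right h0 h01.le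
  have h03 : 0 < U₀₃ := by
    refine h.lt_of_ne fun h => ?_
    rw [← h] at h8; nlinarith [mul_pos (neg_pos.2 h13) h00]
  have := lt_of_mul_lt_of_sq_lt (x := U₀₃) (y := -U₁₃) (p := -U₀₁) (q := -U₀₁) (A := U₁₁)
    (B := U₀₀) h03 (by linarith) (by linarith) (by linarith) h11 (by linarith) h00
  nlinarith

/-- These are the inputs of `minor_neg` and `minor_pos`. They hold because a factor a or b in (0,1)
raises a negative number. -/
theorem gram_inequalities {a b x₀₂ x₀₃ x₁₂ x₁₃ : ℝ} (ha : 0 < a) (ha1 : a < 1) (hb : 0 < b)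
    (hb1 : b < 1) (b02 : -1 < x₀₂) (n02 : x₀₂ < 0) (b03 : -1 < x₀₃) (n03 : x₀₃ < 0)
    (n12 : x₁₂ < 0) (n13 : x₁₃ < 0) (l12 : a * x₀₂ < x₁₂) (l03 : b * x₀₂ < x₀₃)
    (l13 : a * x₀₃ < x₁₃) :
    x₀₂ < x₀₃ * b ∧ x₀₂ < a * x₁₂ ∧ x₀₃ < a * x₁₃ ∧ x₀₃ * x₁₃ < a ∧ x₁₂ * x₁₃ < b := by
  have h1 : x₀₂ < b * x₀₂ := by linarith [mul_neg_of_pos_of_neg (sub_pos.2 hb1) n02]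
  have h2 : x₀₂ < a * x₀₂ := by linarith [mul_neg_of_pos_of_neg (sub_pos.2 ha1) n02]
  have h3 : x₀₃ < a * x₀₃ := by linarith [mul_neg_of_pos_of_neg (sub_pos.2 ha1) n03]
  have h4 : x₀₃ < b * x₀₃ := by linarith [mul_neg_of_pos_of_neg (sub_pos.2 hb1) n03]
  have h5 : x₁₂ < a * x₁₂ := by linarith [mul_neg_of_pos_of_neg (sub_pos.2 ha1) n12]
  have h6 : x₁₃ < a * x₁₃ := by linarith [mul_neg_of_pos_of_neg (sub_pos.2 ha1) n13]
  refine ⟨by linarith, by linarith, by linarith, ?_, ?_⟩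
  · have k1 : x₀₃ * x₁₃ < x₀₃ * (a * x₀₃) := mul_lt_mul_of_neg_left l13 n03
    have k2 : 0 < a * (1 - x₀₃ ^ 2) := mul_pos ha (by nlinarith)
    linarith
  · have k1 : x₁₂ * x₁₃ < x₁₂ * x₀₃ := mul_lt_mul_of_neg_left (by linarith) n12
    have k2 : x₁₂ * x₀₃ < x₀₂ * x₀₃ := mul_lt_mul_of_neg_right (by linarith) n03
    have k3 : x₀₂ * x₀₃ < x₀₂ * (b * x₀₂) := mul_lt_mul_of_neg_left l03 n02
    have k4 : 0 < b * (1 - x₀₂ ^ 2) := mul_pos hb (by nlinarith)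
    linarith

end Real

/-- Signs and inequalities for the Gram matrix of the normals of a simplicial cone at a vertex
whose edges are skew. -/
structure IsSkewGram {E : Type*} [NormedAddCommGroup E] [InnerProductSpace ℝ E]
    (n : Fin 4 → E) : Prop where
  pos_01 : 0 < ⟪n 0, n 1⟫
  pos_23 : 0 < ⟪n 2, n 3⟫
  neg_02 : ⟪n 0, n 2⟫ < 0
  neg_03 : ⟪n 0, n 3⟫ < 0
  neg_12 : ⟪n 1, n 2⟫ < 0
  neg_13 : ⟪n 1, n 3⟫ < 0
  lt_12 : ⟪n 0, n 1⟫ * ⟪n 0, n 2⟫ < ⟪n 1, n 2⟫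
  lt_03 : ⟪n 2, n 3⟫ * ⟪n 0, n 2⟫ < ⟪n 0, n 3⟫
  lt_13 : ⟪n 0, n 1⟫ * ⟪n 0, n 3⟫ < ⟪n 1, n 3⟫

variable {W : Submodule ℝ E}
  {n u : Fin 4 → E}

namespace IsSkewGram

/-- The minors with a sign that does not depend on the order of `⟪n₁, n₂⟫` and `⟪n₁, n₃⟫`. -/
theorem minors (hs : IsSkewGram n) (h : IsDualPair W n u) (hn : ∀ i, ‖n i‖ = 1) :
    ⟪u 0, u 1⟫ * ⟪u 1, u 2⟫ < ⟪u 0, u 2⟫ * ⟪u 1, u 1⟫ ∧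
    ⟪u 0, u 3⟫ * ⟪u 2, u 3⟫ < ⟪u 0, u 2⟫ * ⟪u 3, u 3⟫ ∧
    ⟪u 0, u 2⟫ * ⟪u 2, u 3⟫ < ⟪u 0, u 3⟫ * ⟪u 2, u 2⟫ ∧
    ⟪u 0, u 3⟫ * ⟪u 1, u 1⟫ < ⟪u 0, u 1⟫ * ⟪u 1, u 3⟫ ∧
    ⟪u 1, u 2⟫ * ⟪u 3, u 3⟫ < ⟪u 1, u 3⟫ * ⟪u 2, u 3⟫ ∧
    ⟪u 1, u 3⟫ * ⟪u 2, u 2⟫ < ⟪u 1, u 2⟫ * ⟪u 2, u 3⟫ ∧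
    ⟪u 0, u 1⟫ * ⟪u 2, u 2⟫ < ⟪u 0, u 2⟫ * ⟪u 1, u 2⟫ ∧
    ⟪u 2, u 3⟫ * ⟪u 0, u 0⟫ < ⟪u 0, u 2⟫ * ⟪u 0, u 3⟫ := by
  have d01 := real_inner_comm (u 0) (u 1)
  have d02 := real_inner_comm (u 0) (u 2)
  have d03 := real_inner_comm (u 0) (u 3)
  have d12 := real_inner_comm (u 1) (u 2)
  have d13 := real_inner_comm (u 1) (u 3)
  have d23 := real_inner_comm (u 2) (u 3)
  have c01 := real_inner_comm (n 0) (n 1)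
  have c02 := real_inner_comm (n 0) (n 2)
  have c03 := real_inner_comm (n 0) (n 3)
  have c12 := real_inner_comm (n 1) (n 2)
  have c13 := real_inner_comm (n 1) (n 3)
  have c23 := real_inner_comm (n 2) (n 3)
  have b01 := h.abs_inner_lt_one hn (show (0 : Fin 4) ≠ 1 by decide)
  have b23 := h.abs_inner_lt_one hn (show (2 : Fin 4) ≠ 3 by decide)
  have b02 := h.abs_inner_lt_one hn (show (0 : Fin 4) ≠ 2 by decide)
  have b03 := h.abs_inner_lt_one hn (show (0 : Fin 4) ≠ 3 by decide)
  obtain ⟨p01, p23, n02, n03, n12, n13, l12, l03, l13⟩ := hs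
  obtain ⟨t1, t2, t3, t10, t11⟩ := gram_inequalities p01 b01.2 p23 b23.2 b02.1 n02 b03.1 n03 n12 n13
    l12 l03 l13
  have m1 := h.minor_neg (i := 0) (j := 2) (k := 1) (l := 3) (hn 3) t1
  have m2 := h.minor_neg (i := 0) (j := 2) (k := 3) (l := 1) (hn 1) (by rwa [c12])
  have m3 := h.minor_neg (i := 0) (j := 3) (k := 2) (l := 1) (hn 1) (by rwa [c13])
  have m4 := h.minor_pos (i := 0) (j := 3) (k := 1) (l := 2) (hn 2) (by rw [c23]; linarith)
  have m6 := h.minor_pos (i := 1) (j := 2) (k := 3) (l := 0) (hn 0) (by rwa [c01, c02])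
  have m7 := h.minor_pos (i := 1) (j := 3) (k := 2) (l := 0) (hn 0) (by rwa [c01, c03])
  have m10 := h.minor_pos (i := 0) (j := 1) (k := 2) (l := 3) (hn 3) t10
  have m11 := h.minor_pos (i := 2) (j := 3) (k := 0) (l := 1) (hn 1) (by rwa [c12, c13])
  simp only [d01, d02, d03, d12, d13, d23] at m1 m2 m3 m4 m6 m7 m10 m11
  exact ⟨m1, m2, m3, m4, m6, m7, m10, m11⟩

/-- The relabeling exchanges the two positive pairs, and `lt_12` with `lt_03`. Only `lt_13` has no
counterpart in `hs`; `hlt` supplies it. -/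
theorem swap (hs : IsSkewGram n) (hlt : ⟪n 2, n 3⟫ * ⟪n 1, n 2⟫ < ⟪n 1, n 3⟫) :
    IsSkewGram (n ∘ (Equiv.swap 0 2 * Equiv.swap 1 3 : Equiv.Perm (Fin 4))) := by
  have e0 : (Equiv.swap 0 2 * Equiv.swap 1 3 : Equiv.Perm (Fin 4)) 0 = 2 := by decide
  have e1 : (Equiv.swap 0 2 * Equiv.swap 1 3 : Equiv.Perm (Fin 4)) 1 = 3 := by decide
  have e2 : (Equiv.swap 0 2 * Equiv.swap 1 3 : Equiv.Perm (Fin 4)) 2 = 0 := by decide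
  have e3 : (Equiv.swap 0 2 * Equiv.swap 1 3 : Equiv.Perm (Fin 4)) 3 = 1 := by decide
  obtain ⟨p01, p23, n02, n03, n12, n13, l12, l03, l13⟩ := hs
  have c02 := real_inner_comm (n 0) (n 2)
  have c03 := real_inner_comm (n 0) (n 3)
  have c12 := real_inner_comm (n 1) (n 2)
  have c13 := real_inner_comm (n 1) (n 3)
  constructor <;> simp only [Function.comp, e0, e1, e2, e3, c02, c03, c12, c13] <;> assumption

/-- A good point exists when `⟪u₁, u₂⟫`, `⟪u₂, u₃⟫` and `⟪u₀, u₃⟫` are not positive. -/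
theorem exists_isGoodPoint_of_nonpos (p01 : 0 < ⟪n 0, n 1⟫) (p23 : 0 < ⟪n 2, n 3⟫)
    (n02 : ⟪n 0, n 2⟫ < 0) (n03 : ⟪n 0, n 3⟫ < 0) (n12 : ⟪n 1, n 2⟫ < 0) (n13 : ⟪n 1, n 3⟫ < 0)
    (l12 : ⟪n 0, n 1⟫ * ⟪n 0, n 2⟫ < ⟪n 1, n 2⟫) (l03 : ⟪n 2, n 3⟫ * ⟪n 0, n 2⟫ < ⟪n 0, n 3⟫)
    (h : IsDualPair W n u) (hn : ∀ i, ‖n i‖ = 1)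
    (h12 : ⟪u 1, u 2⟫ ≤ 0) (h23 : ⟪u 2, u 3⟫ ≤ 0) (h03 : ⟪u 0, u 3⟫ ≤ 0)
    (hrow : -⟪n 0, n 2⟫ * ⟪u 0, u 2⟫ < ⟪u 2, u 2⟫) : ∃ Y ∈ W, IsGoodPoint n u Y := by
  have b02 := h.abs_inner_lt_one hn (show (0 : Fin 4) ≠ 2 by decide)
  refine h.exists_isGoodPoint_of_coords hn n02 n03 n12 n13 p01 p23 ?_ (Or.inl h03)
  exact exists_coords_of_nonpos (by linarith) (by linarith) (by linarith) (by linarith)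
    (real_inner_self_pos.2 (h.w_ne_zero 1)) (real_inner_self_pos.2 (h.w_ne_zero 2))
    (real_inner_self_pos.2 (h.w_ne_zero 3)) h12 h23 (h.sq_inner_lt_mul (by decide)) hrow

/-- One of the two rays that are not next to each other is critical for a suitable point. -/
theorem row_lt_or_row_lt (n02 : ⟪n 0, n 2⟫ < 0) (h : IsDualPair W n u) (hn : ∀ i, ‖n i‖ = 1) :
    -⟪n 0, n 2⟫ * ⟪u 0, u 2⟫ < ⟪u 2, u 2⟫ ∨ -⟪n 0, n 2⟫ * ⟪u 0, u 2⟫ < ⟪u 0, u 0⟫ := by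
  -- If both failed, ⟪u 0, u 0⟫ and ⟪u 2, u 2⟫ would both be below ⟪u 0, u 2⟫, against
  -- Cauchy–Schwarz.
  by_contra! hcon
  have b02 := h.abs_inner_lt_one hn (show (0 : Fin 4) ≠ 2 by decide)
  have hsq := h.sq_inner_lt_mul (show (0 : Fin 4) ≠ 2 by decide)
  have h0 := real_inner_self_pos.2 (h.w_ne_zero 0)
  have h2 := real_inner_self_pos.2 (h.w_ne_zero 2)
  have hU : 0 < ⟪u 0, u 2⟫ := pos_of_mul_pos_right (h0.trans_le hcon.2) (by linarith)
  have : ⟪u 0, u 0⟫ < ⟪u 0, u 2⟫ := by nlinarith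
  have : ⟪u 2, u 2⟫ < ⟪u 0, u 2⟫ := by nlinarith
  nlinarith

end IsSkewGram

end

/-! ### Existence of a good point for a skew Gram matrix. -/

section

set_option linter.unusedSimpArgs false



variable {W : Submodule ℝ E}
  {n u : Fin 4 → E}

namespace IsSkewGram

/-- A good point exists when `⟪u₁, u₂⟫` is positive, but not too large. -/
theorem exists_isGoodPoint_of_pos (hs : IsSkewGram n)
    (hlt : ⟪n 2, n 3⟫ * ⟪n 1, n 2⟫ < ⟪n 1, n 3⟫) (h : IsDualPair W n u) (hn : ∀ i, ‖n i‖ = 1)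
    (h12 : 0 < ⟪u 1, u 2⟫) (hc : -⟪n 1, n 2⟫ * ⟪u 1, u 2⟫ < ⟪u 2, u 2⟫) :
    ∃ Y ∈ W, IsGoodPoint n u Y := by
  obtain ⟨m1, m2, m3, m4, m6, m7, m10, m11⟩ := hs.minors h hn
  have b01 := h.abs_inner_lt_one hn (show (0 : Fin 4) ≠ 1 by decide)
  have b23 := h.abs_inner_lt_one hn (show (2 : Fin 4) ≠ 3 by decide)
  have b02 := h.abs_inner_lt_one hn (show (0 : Fin 4) ≠ 2 by decide)
  have b03 := h.abs_inner_lt_one hn (show (0 : Fin 4) ≠ 3 by decide)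
  have q1 := real_inner_self_pos.2 (h.w_ne_zero 1)
  have q2 := real_inner_self_pos.2 (h.w_ne_zero 2)
  have q3 := real_inner_self_pos.2 (h.w_ne_zero 3)
  obtain ⟨h13, h23⟩ := neg_of_pos_of_minors q2 q3 (h.sq_inner_lt_mul (by decide)) m6 m7 h12
  -- As ⟪u 2, u 3⟫ < 0, this diagonal identity yields the last inequality required by
  -- `exists_coords_of_pos`.
  have r := h.gram_mul 2 2
  have hself : ⟪n 2, n 2⟫ = 1 := by rw [real_inner_self_eq_norm_sq, hn, one_pow]
  simp only [Fin.sum_univ_four, if_true, hself, real_inner_comm (n 0) (n 2),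
    real_inner_comm (n 1) (n 2), real_inner_comm (u 2) (u 3)] at r
  obtain ⟨p01, p23, n02, n03, n12, n13, l12, l03, l13⟩ := hs
  have hb := mul_neg_of_pos_of_neg p23 h23
  obtain ⟨-, t2, t3, -, -⟩ := gram_inequalities p01 b01.2 p23 b23.2 b02.1 n02 b03.1 n03 n12 n13
    l12 l03 l13
  refine h.exists_isGoodPoint_of_coords hn n02 n03 n12 n13 p01 p23 ?_
    (Or.inr ⟨by linarith, by linarith⟩)
  refine exists_coords_of_pos b01.2 p01 b23.2 p23 (by linarith) (by linarith) (by linarith)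
    (by linarith) (by linarith) q1 q2 q3 h12 h13 h23 (h.sq_inner_lt_mul (by decide)) m1 hc ?_
  rw [real_inner_comm (u 3) (u 2)] at *
  linarith

/-- The construction with ⟪u 1, u 2⟫ > 0 and its mirror image with ⟪u 0, u 3⟫ > 0 cannot be
obstructed together: entry (0,2) of the inverse-matrix identity, which is 0, would be positive. -/
theorem false_of_le_of_le (hs : IsSkewGram n) (h : IsDualPair W n u) (hn : ∀ i, ‖n i‖ = 1)
    (h12 : 0 < ⟪u 1, u 2⟫) (hc : ⟪u 2, u 2⟫ ≤ -⟪n 1, n 2⟫ * ⟪u 1, u 2⟫)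
    (hc' : 0 < ⟪u 0, u 3⟫ → ⟪u 0, u 0⟫ ≤ -⟪n 0, n 3⟫ * ⟪u 0, u 3⟫) : False := by
  obtain ⟨m1, m2, m3, m4, m6, m7, m10, m11⟩ := hs.minors h hn
  have b02 := h.abs_inner_lt_one hn (show (0 : Fin 4) ≠ 2 by decide)
  have q2 := real_inner_self_pos.2 (h.w_ne_zero 2)
  have q3 := real_inner_self_pos.2 (h.w_ne_zero 3)
  obtain ⟨h13, h23⟩ := neg_of_pos_of_minors q2 q3 (h.sq_inner_lt_mul (by decide)) m6 m7 h12
  have hself : ∀ i, ⟪n i, n i⟫ = 1 := fun i => by rw [real_inner_self_eq_norm_sq, hn, one_pow]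
  have r := h.gram_mul 2 2
  have r' := h.gram_mul 0 2
  rw [if_neg (by decide)] at r'
  have d23 : ⟪u 3, u 2⟫ = ⟪u 2, u 3⟫ := real_inner_comm _ _
  simp only [Fin.sum_univ_four, if_true, hself, real_inner_comm (n 0) (n 2),
    real_inner_comm (n 1) (n 2), d23] at r r'
  obtain ⟨p01, p23, n02, n03, n12, n13, l12, l03, l13⟩ := hs
  have hb := mul_neg_of_pos_of_neg p23 h23
  -- By `r` and `hc`, ⟪n 0, n 2⟫⟪u 0, u 2⟫ ≥ 1 - ⟪n 2, n 3⟫⟪u 2, u 3⟫ > 0.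
  have h02 : ⟪u 0, u 2⟫ < 0 := by
    refine neg_of_mul_pos_right (a := ⟪n 0, n 2⟫) ?_ n02.le
    linarith
  have h03 : 0 < ⟪u 0, u 3⟫ :=
    pos_of_mul_pos_left ((mul_pos_of_neg_of_neg h02 h23).trans m3) q2.le
  have hy : ⟪n 0, n 3⟫ * -⟪u 2, u 3⟫ < ⟪u 0, u 2⟫ := by
    have h1 : ⟪u 2, u 3⟫ * (-⟪n 0, n 3⟫ * ⟪u 0, u 3⟫) ≤ ⟪u 2, u 3⟫ * ⟪u 0, u 0⟫ :=
      mul_le_mul_of_nonpos_left (hc' h03) h23.le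
    refine lt_of_mul_lt_mul_right ?_ h03.le
    linarith
  have hprod : ⟪n 0, n 2⟫ * ⟪n 1, n 2⟫ < ⟪n 0, n 1⟫ := by
    have k1 := mul_lt_mul_of_neg_left l12 n02
    have k2 : 0 < ⟪n 0, n 1⟫ * (1 - ⟪n 0, n 2⟫ ^ 2) := mul_pos p01 (by nlinarith)
    linarith
  have k1 := mul_le_mul_of_nonpos_left hc n02.le
  have k2 := mul_lt_mul_of_pos_right hprod h12
  linarith

/-- In this case the configuration is symmetric under τ. Either `exists_isGoodPoint_of_pos` applies
to it or to its mirror image, or ⟪u 1, u 2⟫ and ⟪u 0, u 3⟫ are both non-positive; then so are ⟪u 0,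
u 1⟫ and ⟪u 2, u 3⟫, and the other construction works on one side. -/
theorem exists_perm_of_lt (hs : IsSkewGram n)
    (hlt : ⟪n 2, n 3⟫ * ⟪n 1, n 2⟫ < ⟪n 1, n 3⟫) (h : IsDualPair W n u) (hn : ∀ i, ‖n i‖ = 1) :
    ∃ σ : Equiv.Perm (Fin 4), ∃ Y ∈ W, IsGoodPoint (n ∘ σ) (u ∘ σ) Y := by
  set τ : Equiv.Perm (Fin 4) := Equiv.swap 0 2 * Equiv.swap 1 3 with hτ
  have e0 : τ 0 = 2 := by decide
  have e1 : τ 1 = 3 := by decide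
  have e2 : τ 2 = 0 := by decide
  have e3 : τ 3 = 1 := by decide
  have hs' : IsSkewGram (n ∘ τ) := hs.swap hlt
  have h' := h.comp_perm τ
  have hn' : ∀ i, ‖(n ∘ τ) i‖ = 1 := fun i => hn _
  have hlt' : ⟪(n ∘ τ) 2, (n ∘ τ) 3⟫ * ⟪(n ∘ τ) 1, (n ∘ τ) 2⟫ < ⟪(n ∘ τ) 1, (n ∘ τ) 3⟫ := by
    simp only [Function.comp, e1, e2, e3, real_inner_comm (n 0) (n 3), real_inner_comm (n 1) (n 3)]
    exact hs.lt_13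
  have hid : n ∘ (1 : Equiv.Perm (Fin 4)) = n ∧ u ∘ (1 : Equiv.Perm (Fin 4)) = u := ⟨rfl, rfl⟩
  obtain ⟨m1, m2, m3, m4, m6, m7, m10, m11⟩ := hs.minors h hn
  obtain ⟨k1, k2, k3, k4, k6, k7, k10, k11⟩ := hs'.minors h' hn'
  have A := hs.exists_isGoodPoint_of_pos hlt h hn
  have B := hs'.exists_isGoodPoint_of_pos hlt' h' hn'
  have C := exists_isGoodPoint_of_nonpos hs.pos_01 hs.pos_23 hs.neg_02 hs.neg_03 hs.neg_12
    hs.neg_13 hs.lt_12 hs.lt_03 h hn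
  have D := exists_isGoodPoint_of_nonpos hs'.pos_01 hs'.pos_23 hs'.neg_02 hs'.neg_03 hs'.neg_12
    hs'.neg_13 hs'.lt_12 hs'.lt_03 h' hn'
  have d01 := real_inner_comm (u 0) (u 1)
  have d02 := real_inner_comm (u 0) (u 2)
  have d03 := real_inner_comm (u 0) (u 3)
  have d12 := real_inner_comm (u 1) (u 2)
  have d13 := real_inner_comm (u 1) (u 3)
  have d23 := real_inner_comm (u 2) (u 3)
  have c02 := real_inner_comm (n 0) (n 2)
  have c03 := real_inner_comm (n 0) (n 3)
  have c12 := real_inner_comm (n 1) (n 2)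
  have c13 := real_inner_comm (n 1) (n 3)
  have c23 := real_inner_comm (n 2) (n 3)
  simp only [Function.comp, e0, e1, e2, e3, d01, d02, d03, d12, d13, d23, c02, c03, c12, c13]
    at k1 k2 k3 k4 k6 k7 k10 k11
  have B' : 0 < ⟪u 0, u 3⟫ → -⟪n 0, n 3⟫ * ⟪u 0, u 3⟫ < ⟪u 0, u 0⟫ →
      ∃ Y ∈ W, IsGoodPoint (n ∘ τ) (u ∘ τ) Y := fun h1 h2 => B
    (by simpa only [Function.comp, e1, e2, d03] using h1)
    (by simpa only [Function.comp, e1, e2, d03, c03] using h2)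
  have D' : ⟪u 0, u 3⟫ ≤ 0 → ⟪u 0, u 1⟫ ≤ 0 → ⟪u 1, u 2⟫ ≤ 0 →
      -⟪n 0, n 2⟫ * ⟪u 0, u 2⟫ < ⟪u 0, u 0⟫ →
      ∃ Y ∈ W, IsGoodPoint (n ∘ τ) (u ∘ τ) Y := fun h1 h2 h3 h4 => D
    (by simpa only [Function.comp, e1, e2, d03] using h1)
    (by simpa only [Function.comp, e2, e3] using h2)
    (by simpa only [Function.comp, e0, e3, d12] using h3)
    (by simpa only [Function.comp, e0, e2, d02, c02] using h4)
  have q0 := real_inner_self_pos.2 (h.w_ne_zero 0)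
  have q1 := real_inner_self_pos.2 (h.w_ne_zero 1)
  have q2 := real_inner_self_pos.2 (h.w_ne_zero 2)
  have q3 := real_inner_self_pos.2 (h.w_ne_zero 3)
  have s01 := h.sq_inner_lt_mul (show (0 : Fin 4) ≠ 1 by decide)
  have s23 := h.sq_inner_lt_mul (show (2 : Fin 4) ≠ 3 by decide)
  by_cases hA : 0 < ⟪u 1, u 2⟫ ∧ -⟪n 1, n 2⟫ * ⟪u 1, u 2⟫ < ⟪u 2, u 2⟫
  · exact ⟨1, A hA.1 hA.2⟩
  by_cases hB : 0 < ⟪u 0, u 3⟫ ∧ -⟪n 0, n 3⟫ * ⟪u 0, u 3⟫ < ⟪u 0, u 0⟫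
  · exact ⟨τ, B' hB.1 hB.2⟩
  push Not at hA hB
  by_cases h12 : 0 < ⟪u 1, u 2⟫
  · exact (hs.false_of_le_of_le h hn h12 (hA h12) hB).elim
  by_cases h03 : 0 < ⟪u 0, u 3⟫
  · refine (hs'.false_of_le_of_le h' hn' ?_ ?_ ?_).elim
    · simpa only [Function.comp, e1, e2, d03] using h03
    · simpa only [Function.comp, e1, e2, d03, c03] using hB h03
    · simpa only [Function.comp, e0, e3, d12, c12] using hA
  push Not at h12 h03
  have h01 : ⟪u 0, u 1⟫ ≤ 0 := nonpos_of_minors q0 q1 q2 s01 m1 (by linarith) m10 h12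
  have h23 : ⟪u 2, u 3⟫ ≤ 0 :=
    nonpos_of_minors q2 q3 q0 s23 (by linarith) (by linarith) m11 h03
  rcases row_lt_or_row_lt hs.neg_02 h hn with hr | hr
  · exact ⟨1, C h12 h23 h03 hr⟩
  · exact ⟨τ, D' h03 h01 h12 hr⟩

/-- A good point exists when `⟪n₁, n₃⟫ < ⟪n₁, n₂⟫`. -/
theorem exists_perm_of_gt (hs : IsSkewGram n)
    (hlt : ⟪n 2, n 3⟫ * ⟪n 1, n 3⟫ < ⟪n 1, n 2⟫) (h : IsDualPair W n u) (hn : ∀ i, ‖n i‖ = 1) :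
    ∃ σ : Equiv.Perm (Fin 4), ∃ Y ∈ W, IsGoodPoint (n ∘ σ) (u ∘ σ) Y := by
  set τ : Equiv.Perm (Fin 4) := Equiv.swap 0 2 * Equiv.swap 1 3 with hτ
  have e0 : τ 0 = 2 := by decide
  have e1 : τ 1 = 3 := by decide
  have e2 : τ 2 = 0 := by decide
  have e3 : τ 3 = 1 := by decide
  have q0 := real_inner_self_pos.2 (h.w_ne_zero 0)
  have q1 := real_inner_self_pos.2 (h.w_ne_zero 1)
  have q2 := real_inner_self_pos.2 (h.w_ne_zero 2)
  have s01 := h.sq_inner_lt_mul (show (0 : Fin 4) ≠ 1 by decide)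
  have s02 := h.sq_inner_lt_mul (show (0 : Fin 4) ≠ 2 by decide)
  have s12 := h.sq_inner_lt_mul (show (1 : Fin 4) ≠ 2 by decide)
  have b23 := h.abs_inner_lt_one hn (show (2 : Fin 4) ≠ 3 by decide)
  obtain ⟨m1, m2, m3, m4, m6, m7, m10, m11⟩ := hs.minors h hn
  obtain ⟨p01, p23, n02, n03, n12, n13, l12, l03, l13⟩ := hs
  have d01 := real_inner_comm (u 0) (u 1)
  have d02 := real_inner_comm (u 0) (u 2)
  have d03 := real_inner_comm (u 0) (u 3)
  have d12 := real_inner_comm (u 1) (u 2)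
  have d13 := real_inner_comm (u 1) (u 3)
  have c02 := real_inner_comm (n 0) (n 2)
  have c03 := real_inner_comm (n 0) (n 3)
  have c12 := real_inner_comm (n 1) (n 2)
  have c13 := real_inner_comm (n 1) (n 3)
  have c23 := real_inner_comm (n 2) (n 3)
  have m5 := h.minor_pos (i := 1) (j := 2) (k := 0) (l := 3) (hn 3) (by linarith)
  have m8 := h.minor_neg (i := 1) (j := 3) (k := 0) (l := 2) (hn 2) (by
    rw [c23]
    have k1 := mul_neg_of_pos_of_neg p23 n13
    have k2 : ⟪n 1, n 3⟫ < ⟪n 2, n 3⟫ * ⟪n 1, n 3⟫ := by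
      linarith [mul_neg_of_pos_of_neg (sub_pos.2 b23.2) n13]
    have k3 := mul_lt_mul_of_pos_right b23.2 (neg_pos.2 n12)
    linarith)
  simp only [d01, d02, d03, d12, d13] at m5 m8
  -- Here the minors determine all the signs that matter, so only the non-positive construction is
  -- needed.
  obtain ⟨h01, h12, h02⟩ := signs_of_minors q0 q1 q2 s01 s02 s12 m1 m5 m10
  have h03 := neg_of_neg_of_minors q0 q1 s01 m4 m8 h01
  have h23 : ⟪u 2, u 3⟫ < 0 := by
    refine neg_of_mul_neg_right (m3.trans (mul_neg_of_neg_of_pos h03 q2)) h02.le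
  rcases row_lt_or_row_lt n02 h hn with hr | hr
  · exact ⟨1, exists_isGoodPoint_of_nonpos p01 p23 n02 n03 n12 n13 l12 l03 h hn h12.le h23.le h03.le
      hr⟩
  -- The image of `lt_13` under τ is not available here, but this construction uses only `lt_12` and
  -- `lt_03`, which τ exchanges.
  · refine ⟨τ, exists_isGoodPoint_of_nonpos ?_ ?_ ?_ ?_ ?_ ?_ ?_ ?_ (h.comp_perm τ) (fun i => hn _)
      ?_ ?_ ?_ ?_⟩ <;>
      simp only [Function.comp, e0, e1, e2, e3, d02, d03, d12, c02, c03, c12, c13] <;>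
      first
      | assumption
      | exact le_of_lt (by assumption)

end IsSkewGram

end

/-! ### Combining the four triangles: labeling the normals. -/

section

variable {W : Submodule ℝ E}
  {n u : Fin 4 → E}

/-- The shape of the Gram matrix of three normals of a simplicial cone when the spherical triangle
they define is not nice. -/
def IsSkewTriple (n : Fin 4 → E) (l : Fin 4) : Prop :=
  ∃ i j k : Fin 4, i ≠ j ∧ i ≠ k ∧ j ≠ k ∧ i ≠ l ∧ j ≠ l ∧ k ≠ l ∧
    0 < ⟪n i, n k⟫ ∧ ⟪n j, n k⟫ < 0 ∧ 1 + ⟪n i, n j⟫ ≤ ⟪n i, n k⟫ + ⟪n j, n k⟫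

theorem eq_or_eq_or_eq_of_ne : ∀ i j k l x : Fin 4, i ≠ j → i ≠ k → j ≠ k → i ≠ l → j ≠ l → k ≠ l →
    x ≠ l → x = i ∨ x = j ∨ x = k := by
  decide

namespace IsDualPair

/-- A skew triple has exactly one positive product. This form makes its data available without
knowing the labels hidden in `IsSkewTriple`. -/
theorem neg_and_le_of_isSkewTriple (h : IsDualPair W n u) (hn : ∀ i, ‖n i‖ = 1) {l : Fin 4}
    (hl : IsSkewTriple n l) {x y z : Fin 4} (hxy : x ≠ y) (hxz : x ≠ z) (hyz : y ≠ z)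
    (hx : x ≠ l) (hy : y ≠ l) (hz : z ≠ l) :
    (0 < ⟪n x, n y⟫ → ⟪n x, n z⟫ < 0 ∧ ⟪n y, n z⟫ < 0 ∧
      (1 + ⟪n x, n z⟫ ≤ ⟪n x, n y⟫ + ⟪n y, n z⟫ ∨ 1 + ⟪n y, n z⟫ ≤ ⟪n x, n y⟫ + ⟪n x, n z⟫)) ∧
    (⟪n x, n z⟫ < 0 → ⟪n y, n z⟫ < 0 → 0 < ⟪n x, n y⟫) := by
  obtain ⟨i, j, k, hij, hik, hjk, hil, hjl, hkl, h1, h2, h3⟩ := hl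
  have b := (h.abs_inner_lt_one hn hik).2
  have h4 : ⟪n i, n j⟫ < 0 := by linarith
  have cij := real_inner_comm (n i) (n j)
  have cik := real_inner_comm (n i) (n k)
  have cjk := real_inner_comm (n j) (n k)
  rcases eq_or_eq_or_eq_of_ne i j k l x hij hik hjk hil hjl hkl hx with rfl | rfl | rfl <;>
  rcases eq_or_eq_or_eq_of_ne _ _ _ l y hij hik hjk hil hjl hkl hy with rfl | rfl | rfl <;>
  rcases eq_or_eq_or_eq_of_ne _ _ _ l z hij hik hjk hil hjl hkl hz with rfl | rfl | rfl <;>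
  first
  | exact absurd rfl hxy
  | exact absurd rfl hxz
  | exact absurd rfl hyz
  | (refine ⟨fun h5 => ?_, fun h5 h6 => ?_⟩ <;>
      first
      | linarith
      | exact ⟨by linarith, by linarith, Or.inl (by linarith)⟩
      | exact ⟨by linarith, by linarith, Or.inr (by linarith)⟩)

/-- The main existence result for labeled normals. -/
theorem exists_isGoodPoint_of_order (h : IsDualPair W n u) (hn : ∀ i, ‖n i‖ = 1) (x : Fin 4 → Fin 4)
    (hx : Function.Injective x)
    (p01 : 0 < ⟪n (x 0), n (x 1)⟫) (p23 : 0 < ⟪n (x 2), n (x 3)⟫)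
    (n02 : ⟪n (x 0), n (x 2)⟫ < 0) (n03 : ⟪n (x 0), n (x 3)⟫ < 0)
    (n12 : ⟪n (x 1), n (x 2)⟫ < 0) (n13 : ⟪n (x 1), n (x 3)⟫ < 0)
    (l12 : 1 + ⟪n (x 0), n (x 2)⟫ ≤ ⟪n (x 0), n (x 1)⟫ + ⟪n (x 1), n (x 2)⟫)
    (l03 : 1 + ⟪n (x 0), n (x 2)⟫ ≤ ⟪n (x 2), n (x 3)⟫ + ⟪n (x 0), n (x 3)⟫)
    (l13 : 1 + ⟪n (x 0), n (x 3)⟫ ≤ ⟪n (x 0), n (x 1)⟫ + ⟪n (x 1), n (x 3)⟫)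
    (hor : 1 + ⟪n (x 1), n (x 2)⟫ ≤ ⟪n (x 2), n (x 3)⟫ + ⟪n (x 1), n (x 3)⟫ ∨
      1 + ⟪n (x 1), n (x 3)⟫ ≤ ⟪n (x 2), n (x 3)⟫ + ⟪n (x 1), n (x 2)⟫) :
    ∃ σ : Equiv.Perm (Fin 4), ∃ Y ∈ W, IsGoodPoint (n ∘ σ) (u ∘ σ) Y := by
  set τ : Equiv.Perm (Fin 4) := Equiv.ofBijective x (Finite.injective_iff_bijective.1 hx) with hτ
  have hτx : ∀ i, τ i = x i := fun i => rfl
  have hn' : ∀ i, ‖(n ∘ τ) i‖ = 1 := fun i => hn _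
  -- The triangle inequalities are weakened to the product form of `IsSkewGram` by (1 - a)(1 + s) >
  -- 0.
  have key : ∀ {a s t : ℝ}, a < 1 → -1 < s → 1 + s ≤ a + t → a * s < t := by
    intro a s t h1 h2 h3
    nlinarith [mul_pos (sub_pos.2 h1) (show 0 < 1 + s by linarith)]
  have B := fun {i j : Fin 4} (hij : i ≠ j) => h.abs_inner_lt_one hn (hx.ne hij)
  have hs : IsSkewGram (n ∘ τ) := by
    constructor <;> simp only [Function.comp, hτx] <;> try assumption
    · exact key (B (by decide)).2 (B (by decide)).1 l12
    · exact key (B (by decide)).2 (B (by decide)).1 l03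
    · exact key (B (by decide)).2 (B (by decide)).1 l13
  rcases hor with hor | hor
  · obtain ⟨σ, Y, hY⟩ := hs.exists_perm_of_lt
      (key (B (i := 2) (j := 3) (by decide)).2 (B (by decide)).1 hor) (h.comp_perm τ) hn'
    exact ⟨τ * σ, Y, hY⟩
  · obtain ⟨σ, Y, hY⟩ := hs.exists_perm_of_gt
      (key (B (i := 2) (j := 3) (by decide)).2 (B (by decide)).1 hor) (h.comp_perm τ) hn'
    exact ⟨τ * σ, Y, hY⟩

/-- One positive pair per triangle gives the matching {x,y}, {z,l}. The negative products form the
4-cycle x, z, y, l, and each triangle says which of its two negative products is smaller; the cases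
are the possible orientations. -/
theorem exists_isGoodPoint (h : IsDualPair W n u) (hn : ∀ i, ‖n i‖ = 1)
    (H : ∀ l, IsSkewTriple n l) :
    ∃ σ : Equiv.Perm (Fin 4), ∃ Y ∈ W, IsGoodPoint (n ∘ σ) (u ∘ σ) Y := by
  obtain ⟨x, z, y, hxz, hxy, hzy, hxl, hzl, hyl, p01, n12, lA⟩ := H 3
  generalize (3 : Fin 4) = l at hxl hzl hyl
  have n02 : ⟪n x, n z⟫ < 0 := by linarith [(h.abs_inner_lt_one hn hxy).2]
  obtain ⟨n03, n13, hC⟩ := (h.neg_and_le_of_isSkewTriple hn (H z) hxy hxl hyl hxz hzy.symm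
    hzl.symm).1 p01
  have czx := real_inner_comm (n x) (n z)
  have czy := real_inner_comm (n y) (n z)
  have clx := real_inner_comm (n x) (n l)
  have cly := real_inner_comm (n y) (n l)
  have clz := real_inner_comm (n z) (n l)
  have cyx := real_inner_comm (n x) (n y)
  have p23 : 0 < ⟪n z, n l⟫ :=
    (h.neg_and_le_of_isSkewTriple hn (H y) hzl hxz.symm hxl.symm hzy hyl.symm hxy).2
      (czx ▸ n02) (clx ▸ n03)
  obtain ⟨-, -, hB⟩ := (h.neg_and_le_of_isSkewTriple hn (H y) hzl hxz.symm hxl.symm hzy hyl.symm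
    hxy).1 p23
  obtain ⟨-, -, hD⟩ := (h.neg_and_le_of_isSkewTriple hn (H x) hzl hzy hyl.symm hxz.symm hxl.symm
    hxy.symm).1 p23
  rw [czx, clx] at hB
  rw [czy, cly] at hD
  have ord := fun (a b c d : Fin 4) (hd : a ≠ b ∧ a ≠ c ∧ a ≠ d ∧ b ≠ c ∧ b ≠ d ∧ c ≠ d) =>
    h.exists_isGoodPoint_of_order hn ![a, b, c, d] (by
      obtain ⟨h1, h2, h3, h4, h5, h6⟩ := hd
      intro i j hij
      fin_cases i <;> fin_cases j <;> simp_all)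
  simp only [Matrix.cons_val_zero, Matrix.cons_val_one, Matrix.cons_val] at ord
  have b01 := (h.abs_inner_lt_one hn hxy).2
  have b23 := (h.abs_inner_lt_one hn hzl).2
  have hA : 1 + ⟪n x, n z⟫ ≤ ⟪n x, n y⟫ + ⟪n y, n z⟫ := by linarith
  rcases hB with hB | hB <;> rcases hC with hC | hC
  · exact ord x y z l ⟨hxy, hxz, hxl, hzy.symm, hyl, hzl⟩ p01 p23 n02 n03 (by linarith) n13 hA
      (by linarith) hC (by rcases hD with hD | hD; exacts [Or.inl (by linarith), Or.inr (by linarith)])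
  · rcases hD with hD | hD
    · exact ord z l x y ⟨hzl, hxz.symm, hzy, hxl.symm, hyl.symm, hxy⟩ p23 p01 (by linarith)
        (by linarith) (by linarith) (by linarith) (by linarith) (by linarith) (by linarith)
        (Or.inr (by linarith))
    -- Alternating pattern: two opposite products would both be smaller than their neighbours, and
    -- the four inequalities sum to ‖n y - n x - n z + n l‖² ≤ 0, against independence.
    · exfalso
      have h0 : n y - n x - (n z - n l) ≠ 0 := fun h0 => by
        have := congrArg (fun v => ⟪u y, v⟫) h0
        simp [inner_sub_right, h.inner_eq, hxy.symm, hzy.symm, hyl] at this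
      have h1 := real_inner_self_pos.2 h0
      have hs : ∀ x, ⟪n x, n x⟫ = 1 := fun x => by rw [real_inner_self_eq_norm_sq, hn, one_pow]
      simp only [inner_sub_left, inner_sub_right, hs] at h1
      linarith
  · exact ord x y l z ⟨hxy, hxl, hxz, hyl, hzy.symm, hzl.symm⟩ p01 (by linarith) n03 n02 n13
      (by linarith) hC (by linarith) hA
      (by rcases hD with hD | hD; exacts [Or.inr (by linarith), Or.inl (by linarith)])
  · rcases hD with hD | hD
    -- Cyclic pattern: adding the inequalities cancels the negative products and gives 2 ≤ ⟪n x, n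
    -- y⟫ + ⟪n z, n l⟫, but both products are less than 1.
    · exfalso; linarith
    · exact ord l z y x ⟨hzl.symm, hyl.symm, hxl.symm, hzy, hxz.symm, hxy.symm⟩ (by linarith)
        (by linarith) (by linarith) (by linarith) (by linarith) (by linarith) (by linarith)
        (by linarith) (by linarith) (Or.inr (by linarith))

end IsDualPair

end

/-! ### Critical points of a simplicial cone from their active normals. -/

section

/-- `z` is the orthogonal projection of `Y` to the span of the face with active normals `J`, it
lies in the relative interior of this face, and `Y - z` is a non-negative combination of the
active normals. -/
structure IsCriticalFor {ι : Type*} (n u : ι → E) (Y : E) (J : Finset ι) (z : E) : Prop where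
  inner_eq : ∀ j ∈ J, ⟪z, n j⟫ = 0
  inner_pos : ∀ k ∉ J, 0 < ⟪z, n k⟫
  orth : ∀ k ∉ J, ⟪Y - z, u k⟫ = 0
  nonneg : ∀ j ∈ J, 0 ≤ ⟪Y - z, u j⟫

namespace IsCriticalFor

section General

variable {ι : Type*} {n u : ι → E} {Y z : E} {J : Finset ι}

theorem smul (hz : IsCriticalFor n u Y J z) {c : ℝ} (hc : 0 < c) :
    IsCriticalFor n u (c • Y) J (c • z) where
  inner_eq j hj := by rw [real_inner_smul_left, hz.inner_eq j hj, mul_zero]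
  inner_pos k hk := by rw [real_inner_smul_left]; exact mul_pos hc (hz.inner_pos k hk)
  orth k hk := by rw [← smul_sub, real_inner_smul_left, hz.orth k hk, mul_zero]
  nonneg j hj := by
    rw [← smul_sub, real_inner_smul_left]; exact mul_nonneg hc.le (hz.nonneg j hj)

theorem mem_iff (hz : IsCriticalFor n u Y J z) (i : ι) : i ∈ J ↔ ⟪z, n i⟫ = 0 :=
  ⟨hz.inner_eq i, fun h => by_contra fun hi => (hz.inner_pos i hi).ne' h⟩

theorem ne_zero [Fintype ι] (hz : IsCriticalFor n u Y J z) (hJ : J ≠ Finset.univ) : z ≠ 0 := by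
  rintro rfl
  refine hJ (Finset.eq_univ_iff_forall.2 fun i => ?_)
  rw [hz.mem_iff, inner_zero_left]

theorem apex [Fintype ι] (hY : ∀ i, 0 ≤ ⟪Y, u i⟫) : IsCriticalFor n u Y Finset.univ 0 :=
  ⟨by simp, by simp, by simp, by simpa using hY⟩

/-- A critical point determines its set of active normals, so different faces give different points.
-/
theorem card_le_encard {𝒥 : Finset (Finset ι)} {f : Finset ι → E} {T : Set E}
    (hf : ∀ J ∈ 𝒥, f J ∈ T) (hJ : ∀ J ∈ 𝒥, ∀ i, i ∈ J ↔ ⟪f J, n i⟫ = 0) :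
    (𝒥.card : ℕ∞) ≤ T.encard := by
  rw [← Set.encard_coe_eq_coe_finsetCard]
  refine Set.encard_le_encard_of_injOn (f := f) (fun J hJ => hf J hJ) ?_
  intro J hJm J' hJm' heq
  ext i
  rw [hJ J hJm, hJ J' hJm', heq]

variable [Fintype ι] [DecidableEq ι]

theorem inner_sub_self (h : IsDualPair ⊤ n u) (hz : IsCriticalFor n u Y J z) : ⟪Y - z, z⟫ = 0 := by
  rw [real_inner_comm, h.inner_expand (x := z) trivial]
  refine Finset.sum_eq_zero fun i _ => ?_
  by_cases hi : i ∈ J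
  · rw [hz.inner_eq i hi, zero_mul]
  · rw [real_inner_comm (Y - z) (u i), hz.orth i hi, mul_zero]

theorem inner_sub_nonneg (h : IsDualPair ⊤ n u)
    (hz : IsCriticalFor n u Y J z) {x : E} (hx : x ∈ coneFace ⊤ n ∅) :
    0 ≤ ⟪Y - z, x⟫ := by
  rw [real_inner_comm, h.inner_expand (x := x) trivial]
  refine Finset.sum_nonneg fun i _ => mul_nonneg (hx.2.1 i) ?_
  rw [real_inner_comm (Y - z) (u i)]
  by_cases hi : i ∈ J
  · exact hz.nonneg i hi
  · exact (hz.orth i hi).ge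

theorem mem_sphCriticalPoints (h : IsDualPair ⊤ n u)
    (hz : IsCriticalFor n u Y J z) (hY : ‖Y‖ = 1)
    (hYn : ∀ i, 0 < ⟪Y, n i⟫) (hJ : J ≠ Finset.univ) (hne : J.Nonempty) :
    ‖z‖⁻¹ • z ∈ {z ∈ sphCriticalPoints (sphFace ⊤ n ∅) Y |
      InnerProductGeometry.angle Y z < Real.pi / 2} := by
  have hz0 := hz.ne_zero hJ
  have hzn : 0 < ‖z‖⁻¹ := inv_pos.2 (norm_pos_iff.2 hz0)
  have hYz : ⟪Y, z⟫ = ‖z‖ ^ 2 := by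
    have := hz.inner_sub_self h
    rw [inner_sub_left, real_inner_self_eq_norm_sq] at this
    linarith
  have hproj := h.sphProjectsTo (J := J) (X := Y) hz0 trivial hz.inner_eq hz.inner_pos hz.orth
  -- The sum of the active normals supports the simplex exactly along this face.
  refine ⟨⟨sphFace ⊤ n J, ⟨⟨_, hproj.1.1⟩, fun heq => ?_, ∑ j ∈ J, n j, fun x hx => ?_, ?_⟩, hproj,
    fun x hx => ?_⟩, ?_⟩
  · obtain ⟨j, hj⟩ := hne
    have hYm : Y ∈ sphFace ⊤ n ∅ := ⟨hY, trivial, fun i => (hYn i).le, by simp⟩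
    rw [← heq] at hYm
    exact (hYn j).ne' (hYm.2.2.2 j hj)
  · rw [sum_inner]
    exact Finset.sum_nonneg fun j _ => by rw [real_inner_comm]; exact hx.2.2.1 j
  · ext x
    constructor
    · intro hx
      refine ⟨⟨hx.1, trivial, hx.2.2.1, by simp⟩, ?_⟩
      rw [sum_inner]
      exact Finset.sum_eq_zero fun j hj => by rw [real_inner_comm]; exact hx.2.2.2 j hj
    · rintro ⟨hx, h0⟩
      rw [sum_inner, Finset.sum_eq_zero_iff_of_nonneg
        fun j _ => by rw [real_inner_comm]; exact hx.2.2.1 j] at h0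
      exact ⟨hx.1, trivial, hx.2.2.1, fun j hj => by rw [real_inner_comm]; exact h0 j hj⟩
  · rw [angle_le_pi_div_two_iff]
    -- Since ⟪Y, z⟫ = ‖z‖², the component of Y along the normalized z is z itself, and the spherical
    -- condition becomes the Euclidean one.
    have e1 : sphDir (‖z‖⁻¹ • z) Y = Y - z := by
      rw [sphDir, real_inner_smul_left, real_inner_comm, hYz, smul_smul]
      have : ‖z‖⁻¹ * ‖z‖ ^ 2 * ‖z‖⁻¹ = 1 := by
        have := norm_ne_zero_iff.2 hz0
        field_simp
      rw [this, one_smul]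
    rw [e1, sphDir, inner_sub_right, real_inner_smul_right, real_inner_smul_right,
      hz.inner_sub_self h, mul_zero, mul_zero, sub_zero]
    exact hz.inner_sub_nonneg h hx.2
  · apply angle_lt_pi_div_two_of_inner_pos
    rw [real_inner_smul_right, hYz]
    exact mul_pos hzn (pow_pos (norm_pos_iff.2 hz0) 2)

theorem mem_criticalPoints (h : IsDualPair ⊤ n u)
    (hz : IsCriticalFor n u Y J z) (V : E) (hYn : ∀ i, 0 < ⟪Y, n i⟫)
    (hne : J.Nonempty) : V + z ∈ criticalPoints {x | x - V ∈ coneFace ⊤ n ∅} (V + Y) := by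
  refine ⟨{x | x - V ∈ coneFace ⊤ n J}, ⟨⟨V, ?_⟩, fun heq => ?_, fun _ => ?_⟩,
    mem_intrinsicInterior_coneFace V trivial hz.inner_eq hz.inner_pos, ?_, fun x hx => ?_⟩
  · simp [coneFace]
  · obtain ⟨j, hj⟩ := hne
    have hYm : V + Y ∈ {x | x - V ∈ coneFace ⊤ n ∅} :=
      ⟨trivial, fun i => by simpa using (hYn i).le, by simp⟩
    rw [← heq] at hYm
    have := hYm.2.2 j hj
    rw [add_sub_cancel_left] at this
    exact (hYn j).ne' this
  · have hl : ∀ x, (-innerSL ℝ (∑ j ∈ J, n j)) x =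
        -(∑ j ∈ J, ⟪x - V, n j⟫) - ∑ j ∈ J, ⟪V, n j⟫ := by
      intro x
      simp only [neg_apply, innerSL_apply_apply, sum_inner, inner_sub_left, Finset.sum_sub_distrib]
      simp only [real_inner_comm x]
      ring
    refine ⟨-innerSL ℝ (∑ j ∈ J, n j), ?_⟩
    ext x
    constructor
    · intro hx
      refine ⟨⟨trivial, hx.2.1, by simp⟩, fun y hy => ?_⟩
      rw [hl, hl, Finset.sum_eq_zero fun j hj => hx.2.2 j hj]
      have := Finset.sum_nonneg fun j (_ : j ∈ J) => hy.2.1 j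
      linarith
    · rintro ⟨hx, hmax⟩
      have hV := hmax V (by simp [coneFace])
      rw [hl, hl] at hV
      simp only [sub_self, inner_zero_left, Finset.sum_const_zero] at hV
      have hnn := Finset.sum_nonneg fun j (_ : j ∈ J) => hx.2.1 j
      have h0 : ∑ j ∈ J, ⟪x - V, n j⟫ = 0 := by linarith
      rw [Finset.sum_eq_zero_iff_of_nonneg fun j _ => hx.2.1 j] at h0
      exact ⟨trivial, hx.2.1, h0⟩
  · rw [add_sub_add_left_eq_sub, Submodule.mem_orthogonal, vectorSpan_def]
    intro x hx
    induction hx using Submodule.span_induction with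
    | mem y hy =>
      obtain ⟨a, ha, b, hb, rfl⟩ := hy
      have e : a -ᵥ b = (a - V) - (b - V) := by rw [vsub_eq_sub, sub_sub_sub_cancel_right]
      change ⟪a -ᵥ b, Y - z⟫ = 0
      rw [e, inner_sub_left, h.inner_eq_zero_of_mem_coneFace ha hz.orth,
        h.inner_eq_zero_of_mem_coneFace hb hz.orth, sub_zero]
    | zero => simp
    | add a b _ _ ha hb => rw [inner_add_left, ha, hb, add_zero]
    | smul c a _ ha => rw [real_inner_smul_left, ha, mul_zero]
  · rw [EuclideanGeometry.angle, angle_le_pi_div_two_iff, vsub_eq_sub, vsub_eq_sub,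
      add_sub_add_left_eq_sub, ← sub_sub, inner_sub_right, hz.inner_sub_self h, sub_zero]
    exact hz.inner_sub_nonneg h hx

theorem facet (h : IsDualPair ⊤ n u) {i : ι} (hn : ∀ i, ‖n i‖ = 1)
    (hi : 0 ≤ ⟪Y, n i⟫)
    (hf : ∀ j, i ≠ j → ⟪Y, n i⟫ * ⟪n i, n j⟫ < ⟪Y, n j⟫) :
    IsCriticalFor n u Y {i} (Y - ⟪Y, n i⟫ • n i) where
  inner_eq j hj := by
    obtain rfl := Finset.mem_singleton.1 hj
    rw [inner_sub_left, real_inner_smul_left, real_inner_self_eq_norm_sq, hn]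
    ring
  inner_pos k hk := by
    rw [inner_sub_left, real_inner_smul_left]
    exact sub_pos.2 (hf k (by simpa [eq_comm] using hk))
  orth k hk := by
    have : i ≠ k := by simpa [eq_comm] using hk
    simp [real_inner_smul_left, h.symm.inner_eq, this]
  nonneg j hj := by
    obtain rfl := Finset.mem_singleton.1 hj
    simpa [real_inner_smul_left, h.symm.inner_eq] using hi

theorem ray (h : IsDualPair ⊤ n u) {l : ι} (hl : 0 < ⟪Y, u l⟫)
    (hr : ∀ j, l ≠ j → ⟪Y, u l⟫ * ⟪u l, u j⟫ ≤ ⟪Y, u j⟫ * ⟪u l, u l⟫) :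
    IsCriticalFor n u Y {l}ᶜ ((⟪Y, u l⟫ / ⟪u l, u l⟫) • u l) := by
  have hU := real_inner_self_pos.2 (h.w_ne_zero l)
  refine ⟨fun j hj => ?_, fun k hk => ?_, fun k hk => ?_, fun j hj => ?_⟩
  · have : l ≠ j := by simpa [eq_comm] using hj
    simp [real_inner_smul_left, h.inner_eq, this]
  · obtain rfl : k = l := by simpa using hk
    rw [real_inner_smul_left, h.inner_self, mul_one]
    exact div_pos hl hU
  · obtain rfl : k = l := by simpa using hk
    rw [inner_sub_left, real_inner_smul_left, div_mul_cancel₀ _ hU.ne', sub_self]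
  · rw [inner_sub_left, real_inner_smul_left, sub_nonneg, div_mul_eq_mul_div, div_le_iff₀ hU]
    exact hr j (by simpa [eq_comm] using hj)

end General

variable {n u : Fin 4 → E} {Y : E}

/-- By Cramer's rule `hk` and `hl` say that the projection of Y to the plane of `u k`, `u l` has
positive coefficients, while `hi` and `hj` make the multipliers of `n i`, `n j` non-negative. -/
theorem exists_twoFace (h : IsDualPair ⊤ n u) (hn : ∀ i, ‖n i‖ = 1) {i j k l : Fin 4}
    (hi : ⟪Y, n j⟫ * ⟪n i, n j⟫ ≤ ⟪Y, n i⟫) (hj : ⟪Y, n i⟫ * ⟪n i, n j⟫ ≤ ⟪Y, n j⟫)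
    (hk : ⟪Y, u l⟫ * ⟪u k, u l⟫ < ⟪Y, u k⟫ * ⟪u l, u l⟫)
    (hl : ⟪Y, u k⟫ * ⟪u k, u l⟫ < ⟪Y, u l⟫ * ⟪u k, u k⟫)
    (hd : i ≠ j ∧ i ≠ k ∧ i ≠ l ∧ j ≠ k ∧ j ≠ l ∧ k ≠ l := by decide) :
    ∃ z, IsCriticalFor n u Y {i, j} z := by
  obtain ⟨hij, hik, hil, hjk, hjl, hkl⟩ := hd
  have hcov : ∀ x, x ∉ ({i, j} : Finset (Fin 4)) → x = k ∨ x = l := by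
    intro x hx
    simp only [Finset.mem_insert, Finset.mem_singleton, not_or] at hx
    rcases eq_or_eq_or_eq_of_ne k l i j x hkl hik.symm hil.symm hjk.symm hjl.symm hij hx.2 with
      h1 | h1 | h1
    exacts [Or.inl h1, Or.inr h1, absurd h1 hx.1]
  have hD : 0 < ⟪u k, u k⟫ * ⟪u l, u l⟫ - ⟪u k, u l⟫ ^ 2 := sub_pos.2 (h.sq_inner_lt_mul hkl)
  set D := ⟪u k, u k⟫ * ⟪u l, u l⟫ - ⟪u k, u l⟫ ^ 2 with hDdef
  set c := (⟪Y, u k⟫ * ⟪u l, u l⟫ - ⟪Y, u l⟫ * ⟪u k, u l⟫) / D with hc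
  set d := (⟪Y, u l⟫ * ⟪u k, u k⟫ - ⟪Y, u k⟫ * ⟪u k, u l⟫) / D with hdd
  have hc0 : 0 < c := div_pos (sub_pos.2 hk) hD
  have hd0 : 0 < d := div_pos (sub_pos.2 hl) hD
  have hcD : c * D = ⟪Y, u k⟫ * ⟪u l, u l⟫ - ⟪Y, u l⟫ * ⟪u k, u l⟫ := div_mul_cancel₀ _ hD.ne'
  have hdD : d * D = ⟪Y, u l⟫ * ⟪u k, u k⟫ - ⟪Y, u k⟫ * ⟪u k, u l⟫ := div_mul_cancel₀ _ hD.ne'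
  set z := c • u k + d • u l with hz
  have ez : ∀ y, ⟪z, y⟫ = c * ⟪u k, y⟫ + d * ⟪u l, y⟫ := fun y => by
    simp only [hz, inner_add_left, real_inner_smul_left]
  have zi : ⟪z, n i⟫ = 0 := by simp [ez, h.inner_eq, hik.symm, hil.symm]
  have zj : ⟪z, n j⟫ = 0 := by simp [ez, h.inner_eq, hjk.symm, hjl.symm]
  have zk : ⟪Y - z, u k⟫ = 0 := by
    rw [inner_sub_left, ez, real_inner_comm (u k) (u l)]
    refine mul_left_cancel₀ hD.ne' ?_
    linear_combination (-⟪u k, u k⟫) * hcD - ⟪u k, u l⟫ * hdD + ⟪Y, u k⟫ * hDdef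
  have zl : ⟪Y - z, u l⟫ = 0 := by
    rw [inner_sub_left, ez]
    refine mul_left_cancel₀ hD.ne' ?_
    linear_combination (-⟪u k, u l⟫) * hcD - ⟪u l, u l⟫ * hdD + ⟪Y, u l⟫ * hDdef
  have hexp : ∀ y, ⟪Y - z, y⟫ = ⟪Y - z, u i⟫ * ⟪n i, y⟫ + ⟪Y - z, u j⟫ * ⟪n j, y⟫ := by
    intro y
    rw [h.symm.inner_expand (x := Y - z) trivial, ← Finset.sum_pair (f := fun x =>
      ⟪Y - z, u x⟫ * ⟪n x, y⟫) hij]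
    symm
    refine Finset.sum_subset (Finset.subset_univ _) fun x _ hx => ?_
    rcases hcov x hx with rfl | rfl
    · rw [zk, zero_mul]
    · rw [zl, zero_mul]
  have hs : ∀ x, ⟪n x, n x⟫ = 1 := fun x => by rw [real_inner_self_eq_norm_sq, hn, one_pow]
  have ei := hexp (n i)
  have ej := hexp (n j)
  rw [inner_sub_left, zi, sub_zero, hs, real_inner_comm (n i) (n j)] at ei
  rw [inner_sub_left, zj, sub_zero, hs] at ej
  have hN : 0 < 1 - ⟪n i, n j⟫ ^ 2 := sub_pos.2 (h.sq_inner_lt_one hn hij)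
  refine ⟨z, fun x hx => ?_, fun x hx => ?_, fun x hx => ?_, fun x hx => ?_⟩
  · rcases Finset.mem_insert.1 hx with rfl | hx
    · exact zi
    · rw [Finset.mem_singleton.1 hx]; exact zj
  · rcases hcov x hx with rfl | rfl
    · rw [ez]; simpa [h.inner_eq, hkl.symm] using hc0
    · rw [ez]; simpa [h.inner_eq, hkl] using hd0
  · rcases hcov x hx with rfl | rfl
    · exact zk
    · exact zl
  · rcases Finset.mem_insert.1 hx with hx | hx
    · rw [hx]
      refine nonneg_of_mul_nonneg_left (b := 1 - ⟪n i, n j⟫ ^ 2) ?_ hN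
      linear_combination hi + ei - ⟪n i, n j⟫ * ej
    · rw [Finset.mem_singleton.1 hx]
      refine nonneg_of_mul_nonneg_left (b := 1 - ⟪n i, n j⟫ ^ 2) ?_ hN
      linear_combination hj + ej - ⟪n i, n j⟫ * ei

end IsCriticalFor

/-- A good point has eight critical faces different from the apex. -/
theorem IsGoodPoint.exists_critical {n u : Fin 4 → E} {Y : E} (hY : IsGoodPoint n u Y)
    (h : IsDualPair ⊤ n u) (hn : ∀ i, ‖n i‖ = 1) :
    ∃ 𝒥 : Finset (Finset (Fin 4)), 𝒥.card = 8 ∧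
      ∀ J ∈ 𝒥, J.Nonempty ∧ J ≠ Finset.univ ∧ ∃ z, IsCriticalFor n u Y J z := by
  have d01 := real_inner_comm (u 0) (u 1)
  have d02 := real_inner_comm (u 0) (u 2)
  have d03 := real_inner_comm (u 0) (u 3)
  have d12 := real_inner_comm (u 1) (u 2)
  have d13 := real_inner_comm (u 1) (u 3)
  have d23 := real_inner_comm (u 2) (u 3)
  have hray : ∀ l, l ≠ 0 → ∃ z, IsCriticalFor n u Y {l}ᶜ z := fun l hl =>
    ⟨_, IsCriticalFor.ray h (hY.u_pos l) fun j hj => (hY.ray l hl j hj).le⟩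
  -- For normals with negative product the conditions on the multipliers are automatic.
  have hneg : ∀ {i j}, ⟪n i, n j⟫ < 0 → ⟪Y, n j⟫ * ⟪n i, n j⟫ ≤ ⟪Y, n i⟫ ∧
      ⟪Y, n i⟫ * ⟪n i, n j⟫ ≤ ⟪Y, n j⟫ := fun {i j} hij =>
    ⟨(mul_neg_of_pos_of_neg (hY.n_pos j) hij).le.trans (hY.n_pos i).le,
      (mul_neg_of_pos_of_neg (hY.n_pos i) hij).le.trans (hY.n_pos j).le⟩
  have hneg' : ∀ {i j}, ⟪n i, n j⟫ < 0 → ⟪Y, n i⟫ * ⟪n i, n j⟫ < ⟪Y, n j⟫ := fun {i j} hij =>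
    (mul_neg_of_pos_of_neg (hY.n_pos i) hij).trans (hY.n_pos j)
  have r := fun (l j : Fin 4) (hl : l ≠ 0) (hlj : l ≠ j) => hY.ray l hl j hlj
  have f0 : ∃ z, IsCriticalFor n u Y {0} z := by
    refine ⟨_, IsCriticalFor.facet h hn (hY.n_pos 0).le fun j hj => ?_⟩
    fin_cases j
    · exact absurd rfl hj
    · exact hY.facet_0
    · exact hneg' hY.neg_02
    · exact hneg' hY.neg_03
  have f2 : ∃ z, IsCriticalFor n u Y {2} z := by
    refine ⟨_, IsCriticalFor.facet h hn (hY.n_pos 2).le fun j hj => ?_⟩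
    fin_cases j
    · exact hneg' (by rw [real_inner_comm]; exact hY.neg_02)
    · exact hneg' (by rw [real_inner_comm]; exact hY.neg_12)
    · exact absurd rfl hj
    · exact hY.facet_2
  have e02 : ∃ z, IsCriticalFor n u Y {0, 2} z :=
    IsCriticalFor.exists_twoFace h hn (k := 1) (l := 3) (hneg hY.neg_02).1 (hneg hY.neg_02).2
      (d13 ▸ r 3 1 (by decide) (by decide)) (r 1 3 (by decide) (by decide))
  have e03 : ∃ z, IsCriticalFor n u Y {0, 3} z :=
    IsCriticalFor.exists_twoFace h hn (k := 1) (l := 2) (hneg hY.neg_03).1 (hneg hY.neg_03).2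
      (d12 ▸ r 2 1 (by decide) (by decide)) (r 1 2 (by decide) (by decide))
  -- Two facets, three rays and two saddles are fixed; only the active pair `T` of the third saddle
  -- depends on the alternative in `third`.
  have main : ∀ T : Finset (Fin 4), T = {1, 3} ∨ T = {1, 2} ∨ T = {0, 1} →
      (∃ z, IsCriticalFor n u Y T z) → ∃ 𝒥 : Finset (Finset (Fin 4)), 𝒥.card = 8 ∧
      ∀ J ∈ 𝒥, J.Nonempty ∧ J ≠ Finset.univ ∧ ∃ z, IsCriticalFor n u Y J z := by
    intro T hT hTz
    refine ⟨{{0}, {2}, {1}ᶜ, {2}ᶜ, {3}ᶜ, {0, 2}, {0, 3}, T}, ?_, ?_⟩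
    · rcases hT with rfl | rfl | rfl <;> decide
    · intro J hJ
      simp only [Finset.mem_insert, Finset.mem_singleton] at hJ
      rcases hJ with rfl | rfl | rfl | rfl | rfl | rfl | rfl | rfl
      · exact ⟨by decide, by decide, f0⟩
      · exact ⟨by decide, by decide, f2⟩
      · exact ⟨by decide, by decide, hray 1 (by decide)⟩
      · exact ⟨by decide, by decide, hray 2 (by decide)⟩
      · exact ⟨by decide, by decide, hray 3 (by decide)⟩
      · exact ⟨by decide, by decide, e02⟩
      · exact ⟨by decide, by decide, e03⟩
      · refine ⟨?_, ?_, hTz⟩ <;> rcases hT with rfl | rfl | rfl <;> decide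
  rcases hY.third with h3 | h3 | h3
  · exact main _ (Or.inl rfl) (IsCriticalFor.exists_twoFace h hn (k := 0) (l := 2)
      (hneg hY.neg_13).1 (hneg hY.neg_13).2 (d02 ▸ r 2 0 (by decide) (by decide)) h3)
  · exact main _ (Or.inr (Or.inl rfl)) (IsCriticalFor.exists_twoFace h hn (k := 0) (l := 3)
      (hneg hY.neg_12).1 (hneg hY.neg_12).2 (d03 ▸ r 3 0 (by decide) (by decide)) h3)
  · exact main _ (Or.inr (Or.inr rfl)) (IsCriticalFor.exists_twoFace h hn (k := 2) (l := 3)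
      h3 hY.facet_0.le (d23 ▸ r 3 2 (by decide) (by decide)) (r 2 3 (by decide) (by decide)))

end

/-! ### Edges at a vertex and generators of its cone. -/

section

/-- The intersection of `P` with the ray from `V` in the direction `q`. -/
def rayFace (P : Set E) (V q : E) : Set E :=
  {x ∈ P | ∃ t : ℝ, 0 ≤ t ∧ x = V + t • q}

/-- The set `P` contains points in the direction `w` from `V`. -/
def IsFeasible (P : Set E) (V w : E) : Prop := ∃ c : ℝ, 0 < c ∧ V + c • w ∈ P

/-- The directions `q` in the finite set `T` generate the cone of the vertex `V` of `P`, and the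
values of `φ` at these directions are `1`. -/
structure IsRayGenerators (P : Set E) (V : E) (φ : E →ₗ[ℝ] ℝ) (T : Set E) : Prop where
  finite : T.Finite
  apply_eq : ∀ q ∈ T, φ q = 1
  feasible : ∀ q ∈ T, IsFeasible P V q
  sub_mem : ∀ p ∈ P, p - V ∈ PointedCone.hull ℝ T
  notMem : ∀ q ∈ T, q ∉ convexHull ℝ (T \ {q})

theorem vectorSpan_rayFace {P : Set E} {V q : E} (hV : V ∈ P) (hq : IsFeasible P V q) :
    vectorSpan ℝ (rayFace P V q) = Submodule.span ℝ {q} := by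
  obtain ⟨c, hc, hcP⟩ := hq
  have hVe : V ∈ rayFace P V q := ⟨hV, 0, le_rfl, by simp⟩
  have hqe : V + c • q ∈ rayFace P V q := ⟨hcP, c, hc.le, rfl⟩
  refine le_antisymm ?_ ?_
  · rw [vectorSpan_def, Submodule.span_le]
    rintro _ ⟨_, ⟨-, s, -, rfl⟩, _, ⟨-, t, -, rfl⟩, rfl⟩
    change (V + s • q) -ᵥ (V + t • q) ∈ _
    rw [vsub_eq_sub, add_sub_add_left_eq_sub, ← sub_smul]
    exact Submodule.smul_mem _ _ (Submodule.mem_span_singleton_self q)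
  · rw [Submodule.span_singleton_le_iff_mem]
    have := Submodule.smul_mem _ c⁻¹ (vsub_mem_vectorSpan ℝ hqe hVe)
    rwa [vsub_eq_sub, add_sub_cancel_left, smul_smul, inv_mul_cancel₀ hc.ne', one_smul] at this

theorem dim_rayFace {P : Set E} {V q : E} (hV : V ∈ P) (hq0 : q ≠ 0) (hq : IsFeasible P V q) :
    dim (rayFace P V q) = 1 := by
  rw [dim, vectorSpan_rayFace hV hq, finrank_span_singleton hq0]

theorem finrank_vectorSpan_of_nonempty_interior [FiniteDimensional ℝ E] {P : Set E}
    (hP : (interior P).Nonempty) : dim P = Module.finrank ℝ E := by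
  rw [dim, ← direction_affineSpan, affineSpan_eq_top_of_nonempty_interior
    (hP.mono (interior_mono (subset_convexHull ℝ P))), AffineSubspace.direction_top, finrank_top]

/-- A direction in which a functional that is non-negative on the cone of the vertex `V` vanishes
on a single ray gives an edge. -/
theorem isEdge_rayFace [FiniteDimensional ℝ E] {P : Set E} {V q : E} (hP : (interior P).Nonempty)
    (hdim : 2 ≤ Module.finrank ℝ E) (hV : V ∈ P) (hq0 : q ≠ 0) (hq : IsFeasible P V q)
    (h : E →ₗ[ℝ] ℝ) (hhq : h q = 0)
    (hh : ∀ p ∈ P, 0 ≤ h (p - V) ∧ (h (p - V) = 0 → ∃ t : ℝ, 0 ≤ t ∧ p - V = t • q)) :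
    IsEdge P (rayFace P V q) := by
  have hd := dim_rayFace hV hq0 hq
  refine ⟨⟨⟨V, hV, 0, le_rfl, by simp⟩, fun heq => ?_, fun _ =>
    ⟨-LinearMap.toContinuousLinearMap h, ?_⟩⟩, hd⟩
  · rw [heq, finrank_vectorSpan_of_nonempty_interior hP] at hd
    omega
  · have hx : ∀ x, h x = h (x - V) + h V := fun x => by rw [map_sub, sub_add_cancel]
    ext x
    simp only [rayFace, Set.mem_ofPred_eq, neg_apply,
      LinearMap.coe_toContinuousLinearMap', neg_le_neg_iff]
    refine and_congr_right fun hxP => ⟨?_, fun hmin => ?_⟩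
    · rintro ⟨t, -, rfl⟩ y hy
      rw [hx y, map_add, map_smul, hhq, smul_zero]
      linarith [(hh y hy).1]
    · have := hmin V hV
      rw [hx x] at this
      obtain ⟨t, ht, he⟩ := (hh x hxP).2 (le_antisymm (by linarith) (hh x hxP).1)
      exact ⟨t, ht, by rw [← he]; abel⟩

/-- The functional exposing V slices the cone at height 1. The extreme points of this vertex figure
generate the cone, and none is redundant. -/
theorem exists_isRayGenerators [FiniteDimensional ℝ E] {P : Set E} (hP : IsPolytope P) {V : E}
    (hV : IsVertex P V) :
    ∃ φ T, IsRayGenerators P V φ T := by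
  obtain ⟨⟨s, rfl⟩, -⟩ := hP
  obtain ⟨l, hl⟩ := hV.2.2 hV.1
  have hVm : V ∈ {x ∈ convexHull ℝ (s : Set E) | ∀ y ∈ convexHull ℝ (s : Set E), l y ≤ l x} :=
    hl ▸ rfl
  have hpos : ∀ p ∈ convexHull ℝ (s : Set E), p ≠ V → 0 < -l (p - V) := by
    intro p hp hpV
    rw [map_sub, neg_sub, sub_pos]
    refine lt_of_le_of_ne (hVm.2 p hp) fun heq => hpV ?_
    have : p ∈ ({V} : Set E) := by
      rw [hl]
      exact ⟨hp, fun y hy => heq ▸ hVm.2 y hy⟩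
    exact this
  set D : Set E := (fun x => (-l (x - V))⁻¹ • (x - V)) '' (s \ {V}) with hD
  have hDfin : D.Finite := (s.finite_toSet.sdiff).image _
  set T := (convexHull ℝ D).extremePoints ℝ with hT
  have hTD : T ⊆ D := extremePoints_convexHull_subset
  have hTfin := hDfin.subset hTD
  have hhull : convexHull ℝ T = convexHull ℝ D := by
    rw [← (hTfin.isClosed_convexHull ℝ).closure_eq]
    exact closure_convexHull_extremePoints (hDfin.isCompact_convexHull ℝ) (convex_convexHull ℝ D)
  refine ⟨-l.toLinearMap, T, hTfin, fun q hq => ?_, fun q hq => ?_, fun p hp => ?_,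
    fun q hq hqm => ?_⟩
  · obtain ⟨x, ⟨hx, hxV⟩, rfl⟩ := hTD hq
    have := hpos x (subset_convexHull ℝ _ hx) hxV
    change -l ((-l (x - V))⁻¹ • (x - V)) = 1
    rw [map_smul, smul_eq_mul, ← mul_neg, inv_mul_cancel₀ this.ne']
  · obtain ⟨x, ⟨hx, hxV⟩, rfl⟩ := hTD hq
    have := hpos x (subset_convexHull ℝ _ hx) hxV
    refine ⟨_, this, ?_⟩
    rw [smul_smul, mul_inv_cancel₀ this.ne', one_smul, add_sub_cancel]
    exact subset_convexHull ℝ _ hx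
  · have hconv : Convex ℝ {p : E | p - V ∈ PointedCone.hull ℝ T} := by
      intro a ha b hb x y hx hy hxy
      have : x • a + y • b - V = x • (a - V) + y • (b - V) := by
        rw [smul_sub, smul_sub, ← add_sub_add_comm, ← add_smul, hxy, one_smul]
      change x • a + y • b - V ∈ PointedCone.hull ℝ T
      rw [this]
      exact PointedCone.convex _ ha hb hx hy hxy
    refine convexHull_min (fun x hx => ?_) hconv hp
    by_cases hxV : x = V
    · simp [hxV]
    · have := hpos x (subset_convexHull ℝ _ hx) hxV
      have hd : (-l (x - V))⁻¹ • (x - V) ∈ convexHull ℝ T :=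
        hhull ▸ subset_convexHull ℝ _ ⟨x, ⟨hx, hxV⟩, rfl⟩
      have hd' := convexHull_min PointedCone.subset_hull (PointedCone.convex _) hd
      have := PointedCone.smul_mem _ this.le hd'
      rwa [smul_smul, mul_inv_cancel₀ (ne_of_gt ‹_›), one_smul] at this
  · have := ((convex_convexHull ℝ D).mem_extremePoints_iff_mem_sdiff_convexHull_sdiff.1 hq).2
    refine this (convexHull_mono (Set.sdiff_subset_sdiff_left ?_) hqm)
    exact hTD.trans (subset_convexHull ℝ D)

namespace IsRayGenerators

variable {P : Set E} {V : E} {φ : E →ₗ[ℝ] ℝ} {T : Set E}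

theorem ne_zero (h : IsRayGenerators P V φ T) {q : E} (hq : q ∈ T) : q ≠ 0 := by
  rintro rfl
  simpa using h.apply_eq 0 hq

/-- Separate `q` from the hull of the other generators by f. As φ = 1 on `T`, the functional f -
f(q)φ vanishes at `q` and is positive at the others, so it exposes the ray. -/
theorem isEdge [FiniteDimensional ℝ E] (h : IsRayGenerators P V φ T) (hP : (interior P).Nonempty)
    (hdim : 2 ≤ Module.finrank ℝ E) (hV : V ∈ P) {q : E} (hq : q ∈ T) :
    IsEdge P (rayFace P V q) := by
  obtain ⟨f, r, hf, hr⟩ := geometric_hahn_banach_point_closed (convex_convexHull ℝ (T \ {q}))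
    (h.finite.sdiff.isClosed_convexHull ℝ) (h.notMem q hq)
  refine isEdge_rayFace hP hdim hV (h.ne_zero hq) (h.feasible q hq) (f.toLinearMap - f q • φ)
    (by simp [h.apply_eq q hq]) fun p hp => ?_
  have hx := h.sub_mem p hp
  generalize p - V = x at hx
  induction hx using Submodule.span_induction with
  | mem x hx =>
    by_cases hxq : x = q
    · subst hxq
      exact ⟨by simp [h.apply_eq x hx], fun _ => ⟨1, zero_le_one, (one_smul _ _).symm⟩⟩
    · have : 0 < (f.toLinearMap - f q • φ) x := by
        have := hr x (subset_convexHull ℝ _ ⟨hx, hxq⟩)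
        simp [h.apply_eq x hx]
        linarith
      exact ⟨this.le, fun h0 => absurd h0 this.ne'⟩
  | zero => exact ⟨by simp, fun _ => ⟨0, le_rfl, by simp⟩⟩
  | add a b _ _ ha hb =>
    rw [map_add]
    refine ⟨add_nonneg ha.1 hb.1, fun h0 => ?_⟩
    obtain ⟨s, hs, rfl⟩ := ha.2 (by linarith [ha.1, hb.1])
    obtain ⟨t, ht, rfl⟩ := hb.2 (by linarith [ha.1, hb.1])
    exact ⟨s + t, add_nonneg hs ht, (add_smul _ _ _).symm⟩
  | smul c a _ ha =>
    rcases c with ⟨c, hc⟩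
    change 0 ≤ (f.toLinearMap - f q • φ) (c • a) ∧
      ((f.toLinearMap - f q • φ) (c • a) = 0 → ∃ t : ℝ, 0 ≤ t ∧ c • a = t • q)
    rw [map_smul, smul_eq_mul]
    refine ⟨mul_nonneg hc ha.1, fun h0 => ?_⟩
    rcases mul_eq_zero.1 h0 with rfl | h0
    · exact ⟨0, le_rfl, by simp⟩
    · obtain ⟨t, ht, rfl⟩ := ha.2 h0
      exact ⟨c * t, mul_nonneg hc ht, smul_smul _ _ _⟩

theorem injOn_rayFace (h : IsRayGenerators P V φ T) : Set.InjOn (rayFace P V) T := by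
  intro q hq q' hq' heq
  obtain ⟨c, hc, hcP⟩ := h.feasible q hq
  have hm : V + c • q ∈ rayFace P V q := ⟨hcP, c, hc.le, rfl⟩
  rw [heq] at hm
  obtain ⟨-, t, -, ht⟩ := hm
  have ht := add_left_cancel ht
  have := congrArg φ ht
  rw [map_smul, map_smul, h.apply_eq q hq, h.apply_eq q' hq', smul_eq_mul, smul_eq_mul, mul_one,
    mul_one] at this
  subst this
  exact smul_right_injective E hc.ne' ht

theorem span_eq_top [FiniteDimensional ℝ E] (h : IsRayGenerators P V φ T)
    (hP : (interior P).Nonempty) : Submodule.span ℝ T = ⊤ := by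
  have h1 : affineSpan ℝ P = ⊤ :=
    affineSpan_eq_top_of_nonempty_interior (hP.mono (interior_mono (subset_convexHull ℝ P)))
  have h2 : affineSpan ℝ P ≤ AffineSubspace.mk' V (Submodule.span ℝ T) := by
    refine affineSpan_le.2 fun p hp => ?_
    rw [SetLike.mem_coe, AffineSubspace.mem_mk', vsub_eq_sub]
    exact PointedCone.hull_le_span ℝ T (h.sub_mem p hp)
  have := AffineSubspace.direction_le h2
  rw [h1, AffineSubspace.direction_top, AffineSubspace.direction_mk'] at this
  exact top_le_iff.1 this

/-- Generators give distinct edges, so simplicity bounds their number above; they span the space,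
which bounds it below. -/
theorem ncard_eq [FiniteDimensional ℝ E] (h : IsRayGenerators P V φ T) (hP : (interior P).Nonempty)
    (hdim : 2 ≤ Module.finrank ℝ E) (hV : V ∈ P)
    (hs : {e | IsEdge P e ∧ V ∈ e}.encard = Module.finrank ℝ E) :
    T.ncard = Module.finrank ℝ E := by
  refine le_antisymm ?_ ?_
  · have := Set.encard_le_encard_of_injOn (s := T) (t := {e | IsEdge P e ∧ V ∈ e})
      (f := rayFace P V) (fun q hq => ⟨h.isEdge hP hdim hV hq, hV, 0, le_rfl, by simp⟩)
      h.injOn_rayFace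
    rw [hs, ← h.finite.cast_ncard_eq] at this
    exact_mod_cast this
  · have := finrank_span_finset_le_card (R := ℝ) h.finite.toFinset
    rwa [h.finite.coe_toFinset, Set.finrank, h.span_eq_top hP, finrank_top,
      ← Set.ncard_eq_toFinset_card T h.finite] at this

end IsRayGenerators

end

/-! ### Facet normals at a simple vertex and the triangles of its edges. -/

section

theorem IsFeasible.exists_forall_le {P : Set E} (hc : Convex ℝ P) {V w : E} (hV : V ∈ P)
    (hw : IsFeasible P V w) : ∃ c : ℝ, 0 < c ∧ ∀ t, 0 ≤ t → t ≤ c → V + t • w ∈ P := by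
  obtain ⟨c, hc0, hcP⟩ := hw
  refine ⟨c, hc0, fun t ht htc => ?_⟩
  have := hc.add_smul_mem hV hcP (t := t / c) ⟨div_nonneg ht hc0.le, (div_le_one hc0).2 htc⟩
  rwa [smul_smul, div_mul_cancel₀ _ hc0.ne'] at this

theorem IsFeasible.add {P : Set E} (hc : Convex ℝ P) {V v w : E} (hV : V ∈ P)
    (hv : IsFeasible P V v) (hw : IsFeasible P V w) : IsFeasible P V (v + w) := by
  obtain ⟨a, ha, haP⟩ := hv.exists_forall_le hc hV
  obtain ⟨b, hb, hbP⟩ := hw.exists_forall_le hc hV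
  have hm : 0 < min a b := lt_min ha hb
  refine ⟨min a b / 2, half_pos hm, ?_⟩
  have := hc (haP _ hm.le (min_le_left _ _)) (hbP _ hm.le (min_le_right _ _))
    (a := 1 / 2) (b := 1 / 2) (by norm_num) (by norm_num) (by norm_num)
  convert this using 1
  module

theorem IsFeasible.smul {P : Set E} {V v : E} (hV : V ∈ P) (hv : IsFeasible P V v) {t : ℝ}
    (ht : 0 ≤ t) : IsFeasible P V (t • v) := by
  rcases ht.eq_or_lt with rfl | ht
  · exact ⟨1, one_pos, by simpa using hV⟩
  · obtain ⟨c, hc, hcP⟩ := hv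
    refine ⟨c / t, div_pos hc ht, ?_⟩
    rwa [smul_smul, div_mul_cancel₀ _ ht.ne']

/-- The unit vectors `n` are the inner normals of the facets of `P` at the vertex `V`. -/
structure IsVertexNormals {ι : Type*} (P : Set E) (V : E) (n : ι → E) : Prop where
  norm_eq : ∀ i, ‖n i‖ = 1
  isFeasible_iff : ∀ w, IsFeasible P V w ↔ w ∈ coneFace ⊤ n ∅

theorem exists_dual [FiniteDimensional ℝ E] {ι : Type*} [Fintype ι] [DecidableEq ι]
    (b : Module.Basis ι ℝ E) : ∃ n : ι → E, IsDualPair ⊤ n b := by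
  refine ⟨fun i => (InnerProductSpace.toDual ℝ E).symm (LinearMap.toContinuousLinearMap (b.coord i)),
    ?_⟩
  have key : ∀ x i, ⟪x, (InnerProductSpace.toDual ℝ E).symm
      (LinearMap.toContinuousLinearMap (b.coord i))⟫ = b.repr x i := fun x i => by
    rw [real_inner_comm, InnerProductSpace.toDual_symm_apply]
    rfl
  refine ⟨fun i j => ?_, fun _ => trivial, fun _ => trivial, fun x _ => ?_⟩
  · rw [key, b.repr_self, Finsupp.single_apply]
  · simp only [key, b.sum_repr]

/-- Dual bases can be rescaled. -/
theorem IsDualPair.rescale {ι : Type*} [Fintype ι] [DecidableEq ι] {W : Submodule ℝ E}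
    {n u : ι → E} (h : IsDualPair W n u) {c : ι → ℝ} (hc : ∀ i, c i ≠ 0) :
    IsDualPair W (fun i => (c i)⁻¹ • n i) (fun i => c i • u i) where
  inner_eq i j := by
    rw [real_inner_smul_left, real_inner_smul_right, h.inner_eq]
    split_ifs with hij
    · subst hij; field_simp [hc i]
    · simp
  n_mem i := W.smul_mem _ (h.n_mem i)
  w_mem i := W.smul_mem _ (h.w_mem i)
  expand x hx := by
    conv_lhs => rw [h.expand x hx]
    refine Finset.sum_congr rfl fun i _ => ?_
    rw [real_inner_smul_right, smul_smul, mul_comm (c i)⁻¹, mul_assoc, inv_mul_cancel₀ (hc i), mul_one]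

/-- At a vertex of a simple polytope the tangent cone is simplicial. -/
theorem exists_isVertexNormals [FiniteDimensional ℝ E] {P : Set E} (hP : IsPolytope P)
    {V : E} (hV : IsVertex P V) {d : ℕ} (hd : Module.finrank ℝ E = d) (h2 : 2 ≤ d)
    (hs : {e | IsEdge P e ∧ V ∈ e}.encard = Module.finrank ℝ E) :
    ∃ n u : Fin d → E, IsDualPair ⊤ n u ∧ IsVertexNormals P V n := by
  obtain ⟨φ, T, hT⟩ := exists_isRayGenerators hP hV
  have hc : Convex ℝ P := by
    obtain ⟨⟨s, rfl⟩, -⟩ := hP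
    exact convex_convexHull ℝ _
  have hVP : V ∈ P := by
    obtain ⟨l, hl⟩ := hV.2.2 hV.1
    have : V ∈ ({V} : Set E) := rfl
    rw [hl] at this
    exact this.1
  have hcard := hT.ncard_eq hP.2 (hd ▸ h2) hVP hs
  rw [Set.ncard_eq_toFinset_card T hT.finite] at hcard
  let q : Fin d → E := fun i => (hT.finite.toFinset.equivFinOfCardEq (hcard.trans hd)).symm i
  have hqT : ∀ i, q i ∈ T := fun i => hT.finite.mem_toFinset.1 (Subtype.prop _)
  have hqs : ∀ x ∈ T, ∃ i, q i = x := fun x hx =>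
    ⟨hT.finite.toFinset.equivFinOfCardEq (hcard.trans hd) ⟨x, hT.finite.mem_toFinset.2 hx⟩,
      by simp [q]⟩
  have hspan : ⊤ ≤ Submodule.span ℝ (Set.range q) := by
    rw [← hT.span_eq_top hP.2]
    exact Submodule.span_mono fun x hx => hqs x hx
  have hcd : Fintype.card (Fin d) = Module.finrank ℝ E := by simp [hd]
  obtain ⟨m, hm⟩ := exists_dual (basisOfTopLeSpanOfCardEqFinrank q hspan hcd)
  rw [coe_basisOfTopLeSpanOfCardEqFinrank] at hm
  have hm0 : ∀ i, 0 < ‖m i‖ := fun i => norm_pos_iff.2 (hm.symm.w_ne_zero i)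
  -- The normals become unit vectors, and the generators absorb the inverse factors.
  have hD := hm.rescale fun i => (hm0 i).ne'
  refine ⟨_, _, hD, fun i => norm_smul_inv_norm (𝕜 := ℝ) (hm.symm.w_ne_zero i),
    fun w => ⟨fun hw => ⟨trivial, fun i => ?_, by simp⟩, fun hw => ?_⟩⟩
  · have key : ∀ x ∈ PointedCone.hull ℝ T, 0 ≤ ⟪x, m i⟫ := by
      intro x hx
      induction hx using Submodule.span_induction with
      | mem x hx =>
        obtain ⟨j, rfl⟩ := hqs x hx
        rw [hm.inner_eq]
        split_ifs <;> simp
      | zero => simp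
      | add a b _ _ ha hb => rw [inner_add_left]; exact add_nonneg ha hb
      | smul c a _ ha =>
        change 0 ≤ ⟪(c : ℝ) • a, m i⟫
        rw [real_inner_smul_left]
        exact mul_nonneg c.2 ha
    obtain ⟨c, hc0, hcP⟩ := hw
    have := key _ (hT.sub_mem _ hcP)
    rw [add_sub_cancel_left, real_inner_smul_left] at this
    rw [real_inner_smul_right]
    exact mul_nonneg (inv_nonneg.2 (hm0 i).le) (nonneg_of_mul_nonneg_right this hc0)
  · rw [hD.expand w trivial]
    refine Finset.sum_induction _ (IsFeasible P V) (fun _ _ => IsFeasible.add hc hVP)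
      ⟨1, one_pos, by simpa using hVP⟩ fun i _ => ?_
    exact ((hT.feasible _ (hqT i)).smul hVP (hm0 i).le).smul hVP (hw.2.1 i)

namespace IsVertexNormals

section General

variable {ι : Type*} {P : Set E} {V : E} {n u : ι → E}

theorem sub_mem (h : IsVertexNormals P V n) {p : E} (hp : p ∈ P) : p - V ∈ coneFace ⊤ n ∅ :=
  (h.isFeasible_iff _).1 ⟨1, one_pos, by rwa [one_smul, add_sub_cancel]⟩

theorem spher_vertex (h : IsVertexNormals P V n) : spher P {V} = sphFace ⊤ n ∅ := by
  ext x
  simp only [spher, sphFace, vectorSpan_singleton, Submodule.bot_orthogonal_eq_top,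
    intrinsicInterior_singleton, Set.mem_singleton_iff, exists_eq_left, ← h.isFeasible_iff]
  exact and_congr_right fun _ => ⟨fun hx => hx.2, fun hx => ⟨trivial, hx⟩⟩

theorem faceCone_vertex (h : IsVertexNormals P V n) :
    faceCone P {V} = {x | x - V ∈ coneFace ⊤ n ∅} := by
  ext x
  simp only [faceCone, intrinsicInterior_singleton, Set.mem_singleton_iff, exists_eq_left]
  constructor
  · rintro ⟨p, hp, t, ht, rfl⟩
    change V + t • (p - V) - V ∈ coneFace ⊤ n ∅
    rw [add_sub_cancel_left]
    exact smul_mem_coneFace ht (h.sub_mem hp)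
  · intro hx
    obtain ⟨c, hc, hcP⟩ := (h.isFeasible_iff _).2 hx
    refine ⟨_, hcP, c⁻¹, (inv_pos.2 hc).le, ?_⟩
    rw [add_sub_cancel_left, smul_smul, inv_mul_cancel₀ hc.ne', one_smul, add_sub_cancel]

theorem add_mem_interior_faceCone [Finite ι] (h : IsVertexNormals P V n) {Y : E}
    (hY : ∀ i, 0 < ⟪Y, n i⟫) : V + Y ∈ interior (faceCone P {V}) := by
  rw [h.faceCone_vertex]
  refine mem_interior.2 ⟨{x | ∀ i ∉ (∅ : Finset ι), 0 < ⟪x - V, n i⟫}, fun x hx =>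
    ⟨trivial, fun i => (hx i (by simp)).le, by simp⟩, isOpen_forall_inner_pos n ∅ V, ?_⟩
  simpa using hY

end General

section Dual

variable {ι : Type*} [Fintype ι] [DecidableEq ι] {P : Set E} {V : E} {n u : ι → E}

theorem isFeasible (h : IsVertexNormals P V n) (hD : IsDualPair ⊤ n u) (l : ι) :
    IsFeasible P V (u l) :=
  (h.isFeasible_iff _).2 (hD.w_mem_coneFace (by simp))

theorem isEdge [FiniteDimensional ℝ E] (h : IsVertexNormals P V n) (hD : IsDualPair ⊤ n u)
    (hP : (interior P).Nonempty) (hdim : 2 ≤ Module.finrank ℝ E) (hV : V ∈ P) (l : ι) :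
    IsEdge P (rayFace P V (u l)) := by
  have hf : ∀ x, (∑ j ∈ Finset.univ.erase l, (innerSL ℝ (n j)).toLinearMap) x =
      ∑ j ∈ Finset.univ.erase l, ⟪x, n j⟫ := fun x => by
    rw [LinearMap.sum_apply]
    exact Finset.sum_congr rfl fun j _ => real_inner_comm _ _
  refine isEdge_rayFace hP hdim hV (hD.w_ne_zero l) (h.isFeasible hD l)
    (∑ j ∈ Finset.univ.erase l, (innerSL ℝ (n j)).toLinearMap) ?_ fun p hp => ?_
  · rw [hf]
    exact Finset.sum_eq_zero fun j hj => hD.inner_ne (Finset.ne_of_mem_erase hj).symm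
  · have hp := h.sub_mem hp
    rw [hf]
    refine ⟨Finset.sum_nonneg fun j _ => hp.2.1 j, fun h0 => ⟨_, hp.2.1 l, ?_⟩⟩
    rw [Finset.sum_eq_zero_iff_of_nonneg fun j _ => hp.2.1 j] at h0
    conv_lhs => rw [hD.expand (p - V) trivial]
    refine Finset.sum_eq_single l (fun j _ hj => ?_) (by simp)
    rw [h0 j (Finset.mem_erase.2 ⟨hj, Finset.mem_univ j⟩), zero_smul]

/-- Inside the edge the facet `n l` is not active, so only the other normals restrict the
directions. -/
theorem spher_rayFace (h : IsVertexNormals P V n) (hD : IsDualPair ⊤ n u) (hc : Convex ℝ P)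
    (hV : V ∈ P) (l : ι) : spher P (rayFace P V (u l)) =
      sphFace (Submodule.span ℝ {u l})ᗮ (fun j : {j // j ≠ l} => n j) ∅ := by
  have hF := h.isFeasible hD l
  ext v
  simp only [spher, vectorSpan_rayFace hV hF]
  constructor
  · rintro ⟨hv1, hv, x, hx, ε, hε, hxP⟩
    obtain ⟨-, t, ht, rfl⟩ := intrinsicInterior_subset hx
    refine ⟨hv1, hv, fun ⟨j, hj⟩ => ?_, by simp⟩
    have := (h.sub_mem hxP).2.1 j
    rw [add_assoc, add_sub_cancel_left, inner_add_left, real_inner_smul_left,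
      real_inner_smul_left, hD.inner_ne hj.symm, mul_zero, zero_add] at this
    exact nonneg_of_mul_nonneg_right this hε
  · rintro ⟨hv1, hv, hvn, -⟩
    -- Adding enough of `u l` to `v` makes the product with `n l` positive without changing the
    -- others, so the sum is feasible at V.
    set a := |⟪v, n l⟫| + 1 with ha
    have ha0 : 0 < a := by positivity
    have hw : IsFeasible P V (a • u l + v) := by
      refine (h.isFeasible_iff _).2 ⟨trivial, fun j => ?_, by simp⟩
      rw [inner_add_left, real_inner_smul_left]
      by_cases hj : j = l
      · rw [hj, hD.inner_self]
        linarith [neg_abs_le ⟪v, n l⟫]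
      · rw [hD.inner_ne (Ne.symm hj), mul_zero, zero_add]
        exact hvn ⟨j, hj⟩
    obtain ⟨c, hc0, hcP⟩ := hw.exists_forall_le hc hV
    obtain ⟨b, hb0, hbP⟩ := hF.exists_forall_le hc hV
    -- V + k(a u_l + v) lies in P for k ≤ c; the factor 2 keeps the base point V + ka u_l strictly
    -- before V + b u_l, hence inside the edge.
    set k := min c (b / (2 * a)) with hk
    have hk0 : 0 < k := lt_min hc0 (by positivity)
    have hkb : k * a < b := by
      have : k * (2 * a) ≤ b := (le_div_iff₀ (by positivity)).1 (min_le_right _ _)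
      nlinarith [mul_pos hk0 ha0]
    refine ⟨hv1, hv, V + (k * a) • u l, ?_, k, hk0, ?_⟩
    · refine mem_intrinsicInterior_of_isOpen
        (O := {x | 0 < ⟪x - V, n l⟫} ∩ {x | ⟪x - V, n l⟫ < b})
        (A := AffineSubspace.mk' V (Submodule.span ℝ {u l})) ?_
        ((isOpen_lt continuous_const (by fun_prop)).inter
          (isOpen_lt (by fun_prop) continuous_const)) ?_ ?_ ?_
      · rintro _ ⟨-, t, -, rfl⟩
        rw [SetLike.mem_coe, AffineSubspace.mem_mk', vsub_eq_sub, add_sub_cancel_left]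
        exact Submodule.smul_mem _ _ (Submodule.mem_span_singleton_self _)
      · change 0 < ⟪V + (k * a) • u l - V, n l⟫ ∧ ⟪V + (k * a) • u l - V, n l⟫ < b
        rw [add_sub_cancel_left, real_inner_smul_left, hD.inner_self, mul_one]
        exact ⟨mul_pos hk0 ha0, hkb⟩
      · exact ⟨hbP _ (mul_pos hk0 ha0).le hkb.le, _, (mul_pos hk0 ha0).le, rfl⟩
      · rintro x ⟨hx', hxA⟩
        rw [SetLike.mem_coe, AffineSubspace.mem_mk', vsub_eq_sub,
          Submodule.mem_span_singleton] at hxA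
        obtain ⟨t, ht⟩ := hxA
        have hx : 0 < ⟪x - V, n l⟫ ∧ ⟪x - V, n l⟫ < b := hx'
        rw [← ht, real_inner_smul_left, hD.inner_self, mul_one] at hx
        have hx' : x = V + t • u l := by rw [ht, add_sub_cancel]
        exact ⟨hx' ▸ hbP t hx.1.le hx.2.le, t, hx.1.le, hx'⟩
    · have := hcP k hk0.le (min_le_left _ _)
      rwa [smul_add, smul_smul, ← add_assoc] at this

end Dual

end IsVertexNormals

/-- The normals with indices different from `l` are, in the orthogonal complement of `u l`, dual
to the projections of the other generators. -/
theorem IsDualPair.orthogonal {ι : Type*} [Fintype ι] [DecidableEq ι] {n u : ι → E}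
    (h : IsDualPair ⊤ n u) (l : ι) :
    IsDualPair (Submodule.span ℝ {u l})ᗮ (fun j : {j // j ≠ l} => n j)
      (fun j : {j // j ≠ l} => u j - (⟪u j, u l⟫ / ⟪u l, u l⟫) • u l) where
  inner_eq i j := by
    rw [inner_sub_left, real_inner_smul_left, h.inner_ne j.2.symm, mul_zero, sub_zero, h.inner_eq]
    simp [Subtype.ext_iff]
  n_mem j := by
    rw [Submodule.mem_orthogonal_singleton_iff_inner_right]
    exact h.inner_ne j.2.symm
  w_mem j := by
    rw [Submodule.mem_orthogonal_singleton_iff_inner_left, inner_sub_left, real_inner_smul_left,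
      div_mul_cancel₀ _ (real_inner_self_pos.2 (h.w_ne_zero l)).ne', sub_self]
  expand x hx := by
    have hxl := (Submodule.mem_orthogonal_singleton_iff_inner_left).1 hx
    have hl : u l - (⟪u l, u l⟫ / ⟪u l, u l⟫) • u l = 0 := by
      rw [div_self (real_inner_self_pos.2 (h.w_ne_zero l)).ne', one_smul, sub_self]
    have e1 : x = ∑ j, ⟪x, n j⟫ • (u j - (⟪u j, u l⟫ / ⟪u l, u l⟫) • u l) := by
      have := h.inner_expand (x := x) trivial (u l)
      rw [hxl] at this
      simp only [smul_sub, Finset.sum_sub_distrib, ← h.expand x trivial, smul_smul,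
        ← Finset.sum_smul, ← mul_div_assoc, ← Finset.sum_div, ← this, zero_div, zero_smul, sub_zero]
    conv_lhs => rw [e1]
    rw [Fintype.sum_eq_add_sum_subtype_ne _ l, hl, smul_zero, zero_add]

theorem IsVertexNormals.isSkewTriple [FiniteDimensional ℝ E] {P : Set E} {V : E} {n u : Fin 4 → E}
    (h : IsVertexNormals P V n) (hD : IsDualPair ⊤ n u) (hc : Convex ℝ P)
    (hV : V ∈ P) (l : Fin 4) (hs : IsSkewFace P (rayFace P V (u l))) : IsSkewTriple n l := by
  have hT := hs.2.2
  rw [h.spher_rayFace hD hc hV l] at hT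
  obtain ⟨i, j, k, hij, hik, hjk, h1, h2, h3⟩ := (hD.orthogonal l).exists_shape_of_not_isNiceTriangle
    (fun i => h.norm_eq i) (by simp) hT
  exact ⟨i, j, k, Subtype.coe_injective.ne hij, Subtype.coe_injective.ne hik,
    Subtype.coe_injective.ne hjk, i.2, j.2, k.2, h1, h2, h3⟩

theorem coneFace_comp_equiv {ι κ : Type*} (W : Submodule ℝ E) (n : ι → E) (σ : κ ≃ ι) :
    coneFace W (n ∘ σ) ∅ = coneFace W n ∅ := by
  ext x
  simp [coneFace, σ.surjective.forall]

/-- The normals of the vertex in an order for which there is a good point. -/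
theorem IsVertexNormals.exists_isGoodPoint {P : Set E} {V : E} {n u : Fin 4 → E}
    (h : IsVertexNormals P V n) (hD : IsDualPair ⊤ n u) (H : ∀ l, IsSkewTriple n l) :
    ∃ n u : Fin 4 → E, IsVertexNormals P V n ∧ IsDualPair ⊤ n u ∧ ∃ Y, IsGoodPoint n u Y := by
  obtain ⟨σ, Y, -, hY⟩ := hD.exists_isGoodPoint h.norm_eq H
  exact ⟨n ∘ σ, u ∘ σ, ⟨fun i => h.norm_eq _, fun w => by
    rw [coneFace_comp_equiv ⊤ n σ, h.isFeasible_iff]⟩,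
    hD.comp_perm σ, Y, hY⟩

end

end PolytopeNormals

end

theorem mainTheorem5 (P : Set (EuclideanSpace ℝ (Fin 4)))
    (hP : PolytopeNormals.IsPolytope P) (hsimple : PolytopeNormals.IsSimple P)
    (V : EuclideanSpace ℝ (Fin 4)) (hV : PolytopeNormals.IsVertex P V)
    (hskew : ∀ e : Set (EuclideanSpace ℝ (Fin 4)),
      PolytopeNormals.IsEdge P e → V ∈ e → PolytopeNormals.IsSkewFace P e) :
    (∃ Y ∈ PolytopeNormals.sphInterior (PolytopeNormals.spher P {V}),
      8 ≤ {z ∈ PolytopeNormals.sphCriticalPoints (PolytopeNormals.spher P {V}) Y |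
        InnerProductGeometry.angle Y z < Real.pi / 2}.encard) ∧
    PolytopeNormals.IsNiceFace P {V} := by
  have hfin : Module.finrank ℝ (EuclideanSpace ℝ (Fin 4)) = 4 := by simp
  have hc : Convex ℝ P := by
    obtain ⟨⟨s, rfl⟩, -⟩ := hP
    exact convex_convexHull ℝ _
  have hVP : V ∈ P := by
    obtain ⟨l, hl⟩ := hV.2.2 hV.1
    have : V ∈ ({V} : Set (EuclideanSpace ℝ (Fin 4))) := rfl
    rw [hl] at this
    exact this.1
  obtain ⟨m, w, hm, hN⟩ := PolytopeNormals.exists_isVertexNormals hP hV hfin (by norm_num) (hsimple V hV)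
  obtain ⟨n, u, hN, hD, Y, hY⟩ := hN.exists_isGoodPoint hm fun l =>
    hN.isSkewTriple hm hc hVP l (hskew _ (hN.isEdge hm hP.2 (by simp) hVP l)
      ⟨hVP, 0, le_rfl, by simp⟩)
  obtain ⟨𝒥, hcard, h𝒥⟩ := hY.exists_critical hD hN.norm_eq
  choose! hne huniv f hf using h𝒥
  have hY0 : Y ≠ 0 := fun h0 => by
    have := hY.n_pos 0
    simp [h0] at this
  have hYn : 0 < ‖Y‖⁻¹ := inv_pos.2 (norm_pos_iff.2 hY0)
  constructor
  · rw [hN.spher_vertex]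
    refine ⟨‖Y‖⁻¹ • Y, PolytopeNormals.normalize_mem_sphInterior hY0 trivial (by simp) (fun i _ => hY.n_pos i), ?_⟩
    -- Y must be a unit vector here, so Y and its critical points are scaled together, and then each
    -- point is normalized.
    have := PolytopeNormals.IsCriticalFor.card_le_encard (n := n) (𝒥 := 𝒥)
      (f := fun J => ‖‖Y‖⁻¹ • f J‖⁻¹ • ‖Y‖⁻¹ • f J)
      (fun J hJ => ((hf J hJ).smul hYn).mem_sphCriticalPoints hD (norm_smul_inv_norm (𝕜 := ℝ) hY0)
        (fun i => by rw [real_inner_smul_left]; exact mul_pos hYn (hY.n_pos i)) (huniv J hJ)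
        (hne J hJ))
      (fun J hJ i => by
        have h1 := (hf J hJ).smul hYn
        have h2 := norm_ne_zero_iff.2 (h1.ne_zero (huniv J hJ))
        rw [h1.mem_iff]
        generalize ‖Y‖⁻¹ • f J = z at h2 ⊢
        rw [real_inner_smul_left, mul_eq_zero, or_iff_right (inv_ne_zero h2)])
    rwa [hcard] at this
  · refine ⟨hV, 4, by norm_num, by simp [PolytopeNormals.dim, hfin], V + Y,
      hN.add_mem_interior_faceCone hY.n_pos, ?_⟩
    -- The ninth critical point is the apex, where all normals are active; it is critical because
    -- ⟪Y, u i⟫ ≥ 0.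
    have h9 : ∀ J ∈ insert Finset.univ 𝒥, J.Nonempty ∧ ∃ z, PolytopeNormals.IsCriticalFor n u Y J z := by
      intro J hJ
      rcases Finset.mem_insert.1 hJ with rfl | hJ
      · exact ⟨Finset.univ_nonempty, 0, PolytopeNormals.IsCriticalFor.apex fun i => (hY.u_pos i).le⟩
      · exact ⟨hne J hJ, f J, hf J hJ⟩
    choose! hne g hg using h9
    have := PolytopeNormals.IsCriticalFor.card_le_encard (n := n) (f := g)
      (T := (V + ·) ⁻¹' PolytopeNormals.criticalPoints (PolytopeNormals.faceCone P {V}) (V + Y))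
      (fun J hJ => by
        rw [hN.faceCone_vertex]
        exact (hg J hJ).mem_criticalPoints hD V hY.n_pos (hne J hJ))
      (fun J hJ => (hg J hJ).mem_iff)
    rw [Finset.card_insert_of_notMem fun h => huniv _ h rfl, hcard,
      ← (add_right_injective V).encard_image] at this
    exact this.trans (Set.encard_le_encard (Set.image_preimage_subset _ _))
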